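/- Let $F$ be a distribution function on $[0,\infty)$ with a density $f$ such that $f(x)>0$ for all $x\ge 0$, and with finite variance $\sigma^2$. Write $\overline F=1-F$, $e(x)=\int_x^\infty\overline F(t)\,dt/\overline F(x)$ and $F^{-1}(u)=\inf\{x\ge 0: F(x)\ge u\}$. Let $a_n\ge 0$ with $a_n\to 0$ and $na_n\to\infty$, and set $b_n=F^{-1}(1-a_n)$. On one probability space let, for each $n$, $\xi_{n1},\dots,\xi_{nn}$ be independent uniform $(0,1)$ random variables with empirical distribution function $\Gamma_n$, and let $\mathbb U_n(t)=\sqrt n\,(\Gamma_n(t)-t)$; let $\mathbb U$ be a Brownian bridge on $[0,1]$ (with almost surely continuous paths) on the same space. Let $\overline{\mathbb F}_n$ be the empirical survival function of $X_{ni}=F^{-1}(\xi_{ni})$, $1\le i\le n$. Define $$\mathbb Z_n(x)=\frac{1}{1-\Gamma_n(F(x))}\Big\{-\int_x^\infty\mathbb U_n(F(t))\,dt+e(x)\,\mathbb U_n(F(x))\Big\}\quad\text{for }0\le x<F^{-1}\big(\max_i\xi_{ni}\big),$$ $\mathbb Z_n(x)=-\sqrt n\,e(x)$ for $x\ge F^{-1}(\max_i\xi_{ni})$,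 and $$\mathbb Z(x)=\frac{1}{\overline F(x)}\Big\{-\int_x^\infty\mathbb U(F(t))\,dt+e(x)\,\mathbb U(F(x))\Big\},\qquad 0\le x<\infty,$$ where the integral of $\mathbb U(F)$ is the improper integral $\lim_{T\to\infty}\int_x^T$ (which exists almost surely). Let $\mathbb Z''(s)=\mathbb Z(-\log s)\,\overline F(-\log s)$ for $0<s\le 1$, $\mathbb Z''(0)=0$, let $g:[0,\sigma^2]\to[0,1]$ be the inverse of $\tau^2(s)=\operatorname{Var}\mathbb Z''(s)$, and let $\mathbb W(t)=\sigma^{-1}\mathbb Z''(g(\sigma^2t))$, $0\le t\le 1$. Suppose that $\sup_{0\le x\le b_n}|\mathbb Z_n(x)-\mathbb Z(x)|\,\overline F(x)\to 0$ in probability as $n\to\infty$. Then $$\sup_{0\le x\le b_n}\big|\mathbb Z_n(x)\overline{\mathbb F}_n(x)-\mathbb Z(x)\overline F(x)\big|\to 0\quad\text{in probability},$$ and consequently $\sup_{0\le x\le b_n}|\mathbb Z_n(x)\overline{\mathbb F}_n(x)|$ converges in distribution to $\sup_{0\le x<\infty}|\mathbb Z(x)\overline F(x)|$. The suprema $\sup_{0\le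 x\le b_n}|\mathbb Z_n\overline{\mathbb F}_n|$ and $\sup_{0\le x<\infty}|\mathbb Z\overline F|$ are almost surely finite, almost surely $\sup_{0\le x<\infty}|\mathbb Z(x)\overline F(x)|=\sigma\sup_{0\le t\le 1}|\mathbb W(t)|$, and $\mathbb W$ is a standard Brownian motion on $[0,1]$. -/

import Mathlib

open MeasureTheory ProbabilityTheory Filter Topology Set

noncomputable section

namespace MeanResidualLife

/-- The survival function `1 - F`, where `F = cdf μ`. -/
def survival (μ : Measure ℝ) (x : ℝ) : ℝ := 1 - cdf μ x

/-- The mean residual life function `e(x) = E(X - x | X > x) = ∫_x^∞ (1 - F) / (1 - F(x))`. -/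
def meanResidualLife (μ : Measure ℝ) (x : ℝ) : ℝ :=
  (∫ t in Ioi x, survival μ t) / survival μ x

/-- The quantile function `F⁻¹(u) = inf {x ≥ 0 : F(x) ≥ u}` of a law on `[0, ∞)`. -/
def quantile (μ : Measure ℝ) (u : ℝ) : ℝ := sInf {x : ℝ | 0 ≤ x ∧ u ≤ cdf μ x}

/-- The empirical distribution function of the points `x i`: the proportion of `i` with
`x i ≤ t`. -/
def empiricalCdf {n : ℕ} (x : Fin n → ℝ) (t : ℝ) : ℝ :=
  (Nat.card {i : Fin n // x i ≤ t} : ℝ) / n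

/-- The uniform empirical process `√n (Γ_n(t) - t)`. -/
def uniformEmpirical {n : ℕ} (u : Fin n → ℝ) (t : ℝ) : ℝ :=
  √(n : ℝ) * (empiricalCdf u t - t)

/-- The sample `X_i = F⁻¹(u_i)` built from the uniform sample `u`. -/
def quantileSample (μ : Measure ℝ) {n : ℕ} (u : Fin n → ℝ) : Fin n → ℝ :=
  fun i => quantile μ (u i)

/-- The empirical survival function of the sample `X_i = F⁻¹(u_i)`. -/
def empiricalSurvival (μ : Measure ℝ) {n : ℕ} (u : Fin n → ℝ) (x : ℝ) : ℝ :=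
  1 - empiricalCdf (quantileSample μ u) x

/-- The mean residual life process `Z_n` as a function of the uniform sample `u`. It is
`(1 - Γ_n(F(x)))⁻¹ (-∫_x^∞ U_n(F) + e(x) U_n(F(x)))` for `x < F⁻¹(max_i u_i)` and
`-√n e(x)` beyond that point. -/
def empiricalMRL (μ : Measure ℝ) {n : ℕ} (u : Fin n → ℝ) (x : ℝ) : ℝ :=
  open Classical in
  if x < quantile μ (⨆ i, u i) then
    (1 / (1 - empiricalCdf u (cdf μ x))) *
      (-(∫ t in Ioi x, uniformEmpirical u (cdf μ t))
        + meanResidualLife μ x * uniformEmpirical u (cdf μ x))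
  else -√(n : ℝ) * meanResidualLife μ x

/-- The integral over `(x, ∞)` read as an improper integral `lim_{T → ∞} ∫_x^T`; it agrees with
the Lebesgue integral when that one exists. -/
def improperIntegral (g : ℝ → ℝ) (x : ℝ) : ℝ :=
  limUnder atTop (fun T : ℝ => ∫ t in x..T, g t)

/-- The limit process `Z` as a function of the path `v` of the Brownian bridge. The integral is
improper: finiteness of the variance alone makes it converge almost surely, but does not make
it absolutely convergent. -/
def limitMRL (μ : Measure ℝ) (v : ℝ → ℝ) (x : ℝ) : ℝ :=
  (1 / survival μ x) *
    (-(improperIntegral (fun t => v (cdf μ t)) x) + meanResidualLife μ x * v (cdf μ x))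

/-- `sup_{x ∈ s} |g x|`. -/
def supAbs (s : Set ℝ) (g : ℝ → ℝ) : ℝ := sSup ((fun x => |g x|) '' s)

/-- A centered Gaussian process on `[0, 1]` with covariance function `K` and almost surely
continuous paths. Only the values at times in `[0, 1]` matter. -/
structure IsContinuousGaussian {Ω : Type*} [MeasurableSpace Ω] (K : ℝ → ℝ → ℝ)
    (X : ℝ → Ω → ℝ) (P : Measure Ω) : Prop where
  isGaussian : IsGaussianProcess (fun (t : Icc (0 : ℝ) 1) => X t) P
  mean_zero : ∀ t ∈ Icc (0 : ℝ) 1, P[X t] = 0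
  covariance_eq : ∀ s ∈ Icc (0 : ℝ) 1, ∀ t ∈ Icc (0 : ℝ) 1, cov[X s, X t; P] = K s t
  continuous_paths : ∀ᵐ ω ∂P, ContinuousOn (fun t => X t ω) (Icc (0 : ℝ) 1)

/-- Brownian bridge on `[0, 1]`. -/
def IsBrownianBridge {Ω : Type*} [MeasurableSpace Ω] (U : ℝ → Ω → ℝ) (P : Measure Ω) : Prop :=
  IsContinuousGaussian (fun s t => min s t - s * t) U P

/-- Standard Brownian motion on `[0, 1]`. -/
def IsBrownianMotion {Ω : Type*} [MeasurableSpace Ω] (W : ℝ → Ω → ℝ) (P : Measure Ω) : Prop :=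
  IsContinuousGaussian (fun s t => min s t) W P

section TimeReversal

variable {Ω : Type*} [MeasurableSpace Ω]

/-- `Z'' (s) = Z'(-log s)` for `s ∈ (0, 1]`, where `Z' = Z (1 - F)`; and `Z''(0) = Z'(∞) = 0`. -/
def reversedLimit (μ : Measure ℝ) (U : ℝ → Ω → ℝ) (s : ℝ) (ω : Ω) : ℝ :=
  open Classical in
  if s = 0 then 0
  else limitMRL μ (fun u => U u ω) (-Real.log s) * survival μ (-Real.log s)

/-- `τ²(s) = Var Z''(s)`. -/
def tauSq (μ : Measure ℝ) (P : Measure Ω) (U : ℝ → Ω → ℝ) (s : ℝ) : ℝ :=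
  Var[reversedLimit μ U s; P]

/-- The standard deviation `σ` of the law `μ`. -/
def stdDev (μ : Measure ℝ) : ℝ := √(Var[id; μ])

/-- `W(t) = σ⁻¹ Z''(g(σ² t))`, where `g` is the inverse of `τ²` on `[0, 1]`. -/
def timeChangedLimit (μ : Measure ℝ) (P : Measure Ω) (U : ℝ → Ω → ℝ) (t : ℝ) (ω : Ω) : ℝ :=
  (stdDev μ)⁻¹ *
    reversedLimit μ U
      (Function.invFunOn (tauSq μ P U) (Icc (0 : ℝ) 1) (stdDev μ ^ 2 * t)) ω

end TimeReversal

end MeanResidualLife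

end

open MeanResidualLife

set_option linter.unusedSectionVars false

namespace MeanResidualLife

/-! Put m_x(y) = 1_{y > x} (y - x - e(x)). The factor 1 - Γ_n(F(x)) cancels in the product of Z_n
with the empirical survival function, which is therefore √n times the sample mean of m_x
(`empiricalMRL_mul_empiricalSurvival`). The limit Z(1 - F) is the Gaussian counterpart: if U(F(x))
is matched with the centered indicator 1_{y ≤ x} - F(x) in L²(μ), then Z(x)(1 - F(x)) is matched
with m_x. `GaussianClosure` makes this matching an isometry that is stable under limits: matched
variables are jointly Gaussian and centered, with the L² inner products as covariances.

The structure of the limit rests on one computation, `inner_mrlVec`: the inner product of m_x and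
m_y is the squared norm of the one with the larger index. So increments are orthogonal, hence
independent, and the variance falls continuously and strictly from σ² at 0 to 0 at infinity.
Reversing time by s = exp(-x) and using the variance as a clock gives Brownian motion.

The delicate point is the improper integral, which need not converge absolutely. The process ∫_0^T
U(F) + e(T) U(F(T)) has independent increments and converges in mean square, so a maximal inequality
makes it converge almost surely (`ae_exists_tendsto_atTop`). A Kronecker lemma then transfers the
limit to the integral alone (`tendsto_of_tendsto_add_mul`).

For the comparison let q be the ratio of the empirical to the true survival function. The difference
to be controlled is q (Z_n - Z)(1 - F) + (q - 1) Z (1 - F). Chebyshev's inequality on a geometric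
grid, with n a_n → ∞, makes q - 1 uniformly small on [0, b_n] (`tendsto_measure_survival_ratio`),
and Z(1 - F) is almost surely bounded. Since b_n → ∞, the supremum of |Z(1 - F)| over [0, b_n] tends
to that over [0, ∞), and convergence in distribution follows. -/

/-- A life law: a law on `[0, ∞)` without atoms, charging every interval, with finite variance. -/
structure IsLifeLaw (μ : Measure ℝ) : Prop where
  ae_nonneg : ∀ᵐ x ∂μ, 0 ≤ x
  measure_singleton : ∀ x, μ {x} = 0
  measure_Ioc_ne_zero : ∀ x y, 0 ≤ x → x < y → μ (Ioc x y) ≠ 0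
  memLp_two : MemLp id 2 μ

/-- The density enters the proof only here; afterwards only the absence of atoms, the full support
and the second moment matter. -/
lemma isLifeLaw_of_density {μ : Measure ℝ} {f : ℝ → ℝ} (hf : Measurable f)
    (hf_pos : ∀ x, 0 ≤ x → 0 < f x)
    (hμ : μ = (volume.restrict (Ici (0 : ℝ))).withDensity (fun x => ENNReal.ofReal (f x)))
    (hvar : MemLp id 2 μ) : IsLifeLaw μ where
  ae_nonneg := by
    rw [hμ]
    exact (withDensity_absolutelyContinuous _ _).ae_le (ae_restrict_mem measurableSet_Ici)
  measure_singleton x := by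
    rw [hμ]
    exact withDensity_absolutelyContinuous _ _ (by simp)
  measure_Ioc_ne_zero x y hx hxy h := by
    rw [hμ, withDensity_apply _ measurableSet_Ioc,
      Measure.restrict_restrict measurableSet_Ioc,
      inter_eq_left.2 (show Ioc x y ⊆ Ici 0 from fun t ht => hx.trans ht.1.le),
      lintegral_eq_zero_iff (by fun_prop), EventuallyEq, ae_restrict_iff' measurableSet_Ioc] at h
    have h2 : ∀ᵐ t : ℝ, t ∉ Ioc x y := by
      filter_upwards [h] with t ht hmem
      have := hf_pos t (hx.trans hmem.1.le)
      have h3 := ht hmem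
      simp only [Pi.zero_apply, ENNReal.ofReal_eq_zero] at h3
      linarith
    have h4 : volume (Ioc x y) = 0 := by
      simpa only [ae_iff, not_not] using! h2
    rw [Real.volume_Ioc, ENNReal.ofReal_eq_zero] at h4
    linarith
  memLp_two := hvar

/-! ### Survival function, quantile function and integrated tail. -/

section Survival

variable {μ : Measure ℝ} [IsProbabilityMeasure μ]

lemma survival_eq_measureReal (x : ℝ) : survival μ x = μ.real (Ioi x) := by
  rw [survival, cdf_eq_real, ← compl_Iic, probReal_compl_eq_one_sub measurableSet_Iic]

lemma survival_nonneg (x : ℝ) : 0 ≤ survival μ x := sub_nonneg.2 (cdf_le_one μ x)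

lemma survival_le_one (x : ℝ) : survival μ x ≤ 1 := sub_le_self _ (cdf_nonneg μ x)

lemma IsLifeLaw.integrable_id (h : IsLifeLaw μ) : Integrable (fun y => y) μ :=
  h.memLp_two.integrable (by norm_num)

lemma IsLifeLaw.ae_pos (h : IsLifeLaw μ) : ∀ᵐ x ∂μ, 0 < x := by
  have h0 : ∀ᵐ x ∂μ, x ≠ 0 := by
    rw [ae_iff]
    simpa using! h.measure_singleton 0
  filter_upwards [h.ae_nonneg, h0] with x hx hx0 using lt_of_le_of_ne hx hx0.symm

lemma IsLifeLaw.continuous_cdf (h : IsLifeLaw μ) : Continuous (cdf μ) := by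
  rw [continuous_iff_continuousAt]
  intro x
  rw [(monotone_cdf μ).continuousAt_iff_leftLim_eq_rightLim, (cdf μ).rightLim_eq]
  refine le_antisymm ((monotone_cdf μ).leftLim_le le_rfl) ?_
  have h1 := h.measure_singleton x
  rw [← measure_cdf μ, StieltjesFunction.measure_singleton, ENNReal.ofReal_eq_zero] at h1
  linarith

lemma IsLifeLaw.continuous_survival (h : IsLifeLaw μ) : Continuous (survival μ) :=
  continuous_const.sub h.continuous_cdf

lemma IsLifeLaw.cdf_of_nonpos (h : IsLifeLaw μ) {x : ℝ} (hx : x ≤ 0) : cdf μ x = 0 := by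
  rw [cdf_eq_real, measureReal_eq_zero_iff, measure_eq_zero_iff_ae_notMem]
  filter_upwards [h.ae_pos] with y hy hmem
  exact absurd (hy.trans_le (le_trans hmem hx)) (lt_irrefl _)

lemma IsLifeLaw.cdf_strictMonoOn (h : IsLifeLaw μ) : StrictMonoOn (cdf μ) (Ici 0) := by
  intro x hx y _ hxy
  have h1 : 0 < μ.real (Ioc x y) :=
    measureReal_nonneg.lt_of_ne' (by
      rw [Ne, measureReal_eq_zero_iff]; exact h.measure_Ioc_ne_zero x y hx hxy)
  have h2 : μ.real (Iic y) = μ.real (Iic x) + μ.real (Ioc x y) := by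
    rw [← Iic_union_Ioc_eq_Iic hxy.le,
      measureReal_union (Iic_disjoint_Ioc le_rfl) measurableSet_Ioc]
  rw [cdf_eq_real, cdf_eq_real, h2]
  linarith

lemma IsLifeLaw.cdf_lt_one (h : IsLifeLaw μ) (x : ℝ) : cdf μ x < 1 :=
  calc cdf μ x ≤ cdf μ (max x 0) := monotone_cdf μ (le_max_left _ _)
    _ < cdf μ (max x 0 + 1) := h.cdf_strictMonoOn (show (0 : ℝ) ≤ _ from le_max_right _ _)
      (show (0 : ℝ) ≤ _ by positivity) (lt_add_one _)
    _ ≤ 1 := cdf_le_one μ _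

lemma IsLifeLaw.survival_pos (h : IsLifeLaw μ) (x : ℝ) : 0 < survival μ x :=
  sub_pos.2 (h.cdf_lt_one x)

lemma quantile_nonneg (u : ℝ) : 0 ≤ quantile μ u := Real.sInf_nonneg fun _ hx => hx.1

lemma IsLifeLaw.quantile_cdf (h : IsLifeLaw μ) {x : ℝ} (hx : 0 ≤ x) :
    quantile μ (cdf μ x) = x := by
  have : {y : ℝ | 0 ≤ y ∧ cdf μ x ≤ cdf μ y} = Ici x := by
    ext y
    refine ⟨fun hy => (h.cdf_strictMonoOn.le_iff_le hx hy.1).1 hy.2, fun hy => ?_⟩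
    exact ⟨hx.trans hy, monotone_cdf μ hy⟩
  rw [quantile, this, csInf_Ici]

lemma IsLifeLaw.exists_cdf_eq (h : IsLifeLaw μ) {u : ℝ} (hu : u ∈ Ico (0 : ℝ) 1) :
    ∃ x, 0 ≤ x ∧ cdf μ x = u := by
  obtain ⟨b, hb, hb0⟩ := (((tendsto_cdf_atTop μ).eventually_const_lt hu.2).and
    (eventually_ge_atTop 0)).exists
  obtain ⟨x, hx, hxu⟩ := intermediate_value_Icc hb0 h.continuous_cdf.continuousOn
    ⟨(h.cdf_of_nonpos le_rfl).trans_le hu.1, hb.le⟩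
  exact ⟨x, hx.1, hxu⟩

lemma IsLifeLaw.cdf_quantile (h : IsLifeLaw μ) {u : ℝ} (hu : u ∈ Ico (0 : ℝ) 1) :
    cdf μ (quantile μ u) = u := by
  obtain ⟨x, hx, rfl⟩ := h.exists_cdf_eq hu
  rw [h.quantile_cdf hx]

/-- On [0, ∞) the distribution function is strictly increasing onto [0, 1), so the quantile function
is its genuine inverse there. -/
lemma IsLifeLaw.quantile_le_iff (h : IsLifeLaw μ) {u x : ℝ} (hu : u ∈ Ico (0 : ℝ) 1)
    (hx : 0 ≤ x) : quantile μ u ≤ x ↔ u ≤ cdf μ x := by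
  obtain ⟨y, hy, rfl⟩ := h.exists_cdf_eq hu
  rw [h.quantile_cdf hy, h.cdf_strictMonoOn.le_iff_le hy hx]

lemma tendsto_quantile (h : IsLifeLaw μ) {a : ℕ → ℝ} (ha : Tendsto a atTop (𝓝 0))
    (ha' : ∀ᶠ n in atTop, 0 < a n) :
    Tendsto (fun n => quantile μ (1 - a n)) atTop atTop := by
  rw [tendsto_atTop]
  intro b
  have h1 : 0 < survival μ (max b 0) := h.survival_pos _
  filter_upwards [ha', ha.eventually_lt_const h1, ha.eventually_lt_const one_pos] with n h0 h2 h3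
  refine le_of_not_gt fun hlt => ?_
  have h4 := (h.quantile_le_iff (u := 1 - a n) ⟨by linarith, by linarith⟩
    (le_max_right b 0)).1 (hlt.le.trans (le_max_left _ _))
  simp only [survival] at h2
  linarith

/-- The expected excess `E (X - x)⁺` over `x`. -/
noncomputable def excess (μ : Measure ℝ) (x : ℝ) : ℝ := ∫ t in Ioi x, survival μ t

lemma ae_nonneg_posPart (x : ℝ) : 0 ≤ᵐ[μ] fun y => max (y - x) 0 :=
  Eventually.of_forall fun _ => le_max_right _ _

/-- Layer-cake formula for (X - x)⁺, translated by x. Stated for lower integrals so that it also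
yields integrability of the tail. -/
lemma lintegral_survival (x : ℝ) :
    ∫⁻ t in Ioi x, ENNReal.ofReal (survival μ t) = ∫⁻ y, ENNReal.ofReal (max (y - x) 0) ∂μ := by
  rw [lintegral_eq_lintegral_meas_lt μ (ae_nonneg_posPart x)
    (by fun_prop), ← lintegral_indicator measurableSet_Ioi, ← lintegral_indicator measurableSet_Ioi,
    ← lintegral_add_left_eq_self _ x]
  congr 1 with t
  simp only [indicator_apply, mem_Ioi, lt_add_iff_pos_right]
  split_ifs with ht
  · rw [survival_eq_measureReal, ofReal_measureReal]
    congr 1 with y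
    simp only [mem_Ioi, mem_ofPred_eq, lt_max_iff]
    constructor
    · intro h; left; linarith
    · rintro (h | h) <;> linarith
  · rfl

lemma IsLifeLaw.integrable_posPart (h : IsLifeLaw μ) (x : ℝ) :
    Integrable (fun y => max (y - x) 0) μ :=
  (h.integrable_id.sub (integrable_const x)).pos_part

lemma IsLifeLaw.integrableOn_survival (h : IsLifeLaw μ) (x : ℝ) :
    IntegrableOn (survival μ) (Ioi x) := by
  refine ⟨h.continuous_survival.aestronglyMeasurable, ?_⟩
  rw [hasFiniteIntegral_iff_ofReal (Eventually.of_forall survival_nonneg), lintegral_survival,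
    ← hasFiniteIntegral_iff_ofReal (ae_nonneg_posPart x)]
  exact (h.integrable_posPart x).2

lemma IsLifeLaw.excess_eq_integral (h : IsLifeLaw μ) (x : ℝ) :
    excess μ x = ∫ y, max (y - x) 0 ∂μ := by
  rw [excess, integral_eq_lintegral_of_nonneg_ae (Eventually.of_forall survival_nonneg)
    h.continuous_survival.aestronglyMeasurable, lintegral_survival,
    ← integral_eq_lintegral_of_nonneg_ae (ae_nonneg_posPart x)
    (h.integrable_posPart x).1]

lemma IsLifeLaw.excess_sub (h : IsLifeLaw μ) (x y : ℝ) :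
    excess μ x - excess μ y = ∫ t in x..y, survival μ t := by
  rw [excess, excess, intervalIntegral.integral_Ioi_sub_Ioi' (h.integrableOn_survival x)
    (h.integrableOn_survival y)]

lemma IsLifeLaw.hasDerivAt_excess (h : IsLifeLaw μ) (x : ℝ) :
    HasDerivAt (excess μ) (-survival μ x) x := by
  have h1 : excess μ = fun y => excess μ 0 - ∫ t in (0 : ℝ)..y, survival μ t := by
    ext y; rw [← h.excess_sub 0 y]; ring
  rw [h1]
  exact (intervalIntegral.integral_hasDerivAt_right (h.continuous_survival.intervalIntegrable _ _)
    (h.continuous_survival.stronglyMeasurableAtFilter _ _) h.continuous_survival.continuousAt).const_sub _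

lemma IsLifeLaw.continuous_excess (h : IsLifeLaw μ) : Continuous (excess μ) :=
  continuous_iff_continuousAt.2 fun x => (h.hasDerivAt_excess x).continuousAt

lemma IsLifeLaw.excess_pos (h : IsLifeLaw μ) (x : ℝ) : 0 < excess μ x := by
  have h1 : 0 < ∫ t in x..(x + 1), survival μ t :=
    intervalIntegral.intervalIntegral_pos_of_pos (h.continuous_survival.intervalIntegrable _ _)
      h.survival_pos (lt_add_one x)
  have h2 : 0 ≤ excess μ (x + 1) := setIntegral_nonneg measurableSet_Ioi
    fun t _ => survival_nonneg t
  rw [← h.excess_sub] at h1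
  linarith

lemma IsLifeLaw.excess_zero (h : IsLifeLaw μ) : excess μ 0 = ∫ y, y ∂μ := by
  rw [h.excess_eq_integral]
  refine integral_congr_ae ?_
  filter_upwards [h.ae_nonneg] with y hy
  simp [hy]

lemma IsLifeLaw.tendsto_excess (h : IsLifeLaw μ) : Tendsto (excess μ) atTop (𝓝 0) := by
  have h1 : excess μ = fun y => excess μ 0 - ∫ t in (0 : ℝ)..y, survival μ t := by
    ext y; rw [← h.excess_sub 0 y]; ring
  rw [h1]
  have := (intervalIntegral_tendsto_integral_Ioi 0 (h.integrableOn_survival 0)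
    tendsto_id).const_sub (excess μ 0)
  simpa [excess] using this

lemma meanResidualLife_eq (x : ℝ) : meanResidualLife μ x = excess μ x / survival μ x := rfl

lemma IsLifeLaw.meanResidualLife_mul_survival (h : IsLifeLaw μ) (x : ℝ) :
    meanResidualLife μ x * survival μ x = excess μ x :=
  div_mul_cancel₀ _ (h.survival_pos x).ne'

lemma IsLifeLaw.continuous_meanResidualLife (h : IsLifeLaw μ) :
    Continuous (meanResidualLife μ) :=
  h.continuous_excess.div₀ h.continuous_survival fun x => (h.survival_pos x).ne'

end Survival

/-! ### An isometry between Gaussian variables and Hilbert space vectors. -/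

section GaussianClosure

variable {Ω : Type*} [MeasurableSpace Ω] {P : Measure Ω} [IsProbabilityMeasure P]
  {H : Type*} [NormedAddCommGroup H] [InnerProductSpace ℝ H]

/-- Almost sure convergence gives convergence of characteristic functions, and those of centered
normals depend continuously on the variance. -/
lemma hasLaw_gaussianReal_of_tendsto {y : ℕ → Ω → ℝ} {z : Ω → ℝ} {v : ℕ → NNReal} {w : NNReal}
    (hy : ∀ n, HasLaw (y n) (gaussianReal 0 (v n)) P) (hv : Tendsto v atTop (𝓝 w))
    (hlim : ∀ᵐ ω ∂P, Tendsto (fun n => y n ω) atTop (𝓝 (z ω))) :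
    HasLaw z (gaussianReal 0 w) P := by
  have hz : AEMeasurable z P := aemeasurable_of_tendsto_metrizable_ae' (fun n => (hy n).aemeasurable) hlim
  have : IsProbabilityMeasure (P.map z) := Measure.isProbabilityMeasure_map hz
  refine ⟨hz, Measure.ext_of_charFun ?_⟩
  ext t
  have h1 := (tendstoInDistribution_of_ae_tendsto (fun n => (hy n).aemeasurable) hz hlim).tendsto
  have h2 := ProbabilityMeasure.tendsto_iff_tendsto_charFun.1 h1 t
  simp only [ProbabilityMeasure.coe_mk, (hy _).map_eq] at h2
  refine tendsto_nhds_unique h2 ?_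
  simp only [charFun_gaussianReal]
  refine (Complex.continuous_exp.tendsto _).comp ?_
  refine Tendsto.sub tendsto_const_nhds (Tendsto.div_const (Tendsto.mul_const _ ?_) _)
  exact ((Complex.continuous_ofReal.comp NNReal.continuous_coe).tendsto w).comp hv

/-- The closure of a set of pairs (random variable, vector) under limits, almost sure in the first
component and in norm in the second. -/
inductive GaussianClosure (P : Measure Ω) (G : Submodule ℝ ((Ω → ℝ) × H)) : (Ω → ℝ) → H → Prop
  | base (y : Ω → ℝ) (h : H) (hG : (y, h) ∈ G) : GaussianClosure P G y h
  | lim (y : ℕ → Ω → ℝ) (h : ℕ → H) (z : Ω → ℝ) (k : H)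
      (hyh : ∀ n, GaussianClosure P G (y n) (h n))
      (hy : ∀ᵐ ω ∂P, Tendsto (fun n => y n ω) atTop (𝓝 (z ω)))
      (hh : Tendsto h atTop (𝓝 k)) : GaussianClosure P G z k

namespace GaussianClosure

variable {G : Submodule ℝ ((Ω → ℝ) × H)} {y z : Ω → ℝ} {h k : H}

lemma congr (hy : GaussianClosure P G y h) (hyz : y =ᵐ[P] z) : GaussianClosure P G z h :=
  .lim (fun _ => y) (fun _ => h) z h (fun _ => hy)
    (by filter_upwards [hyz] with ω hω; rw [hω]; exact tendsto_const_nhds) tendsto_const_nhds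

lemma smul (c : ℝ) (hy : GaussianClosure P G y h) : GaussianClosure P G (c • y) (c • h) := by
  induction hy with
  | base y h hG => exact .base _ _ (G.smul_mem c hG)
  | lim y h z k _ hy hh ih =>
    exact .lim _ _ _ _ ih (by filter_upwards [hy] with ω hω using hω.const_mul c) (hh.const_smul c)

lemma add (hy : GaussianClosure P G y h) (hz : GaussianClosure P G z k) :
    GaussianClosure P G (y + z) (h + k) := by
  induction hy with
  | base y h hG =>
    induction hz with
    | base z k hG' => exact .base _ _ (G.add_mem hG hG')
    | lim z k z' k' _ hz hk ih =>
      exact .lim _ _ _ _ ih (by filter_upwards [hz] with ω hω using hω.const_add _) (hk.const_add _)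
  | lim y h y' h' _ hy hh ih =>
    exact .lim _ _ _ _ ih (by filter_upwards [hy] with ω hω using hω.add_const _) (hh.add_const _)

lemma sub (hy : GaussianClosure P G y h) (hz : GaussianClosure P G z k) :
    GaussianClosure P G (y - z) (h - k) := by
  simpa [sub_eq_add_neg] using hy.add (hz.smul (-1))

lemma zero : GaussianClosure P G 0 0 := .base _ _ G.zero_mem

lemma sum {ι : Type*} (s : Finset ι) {y : ι → Ω → ℝ} {h : ι → H}
    (hy : ∀ i ∈ s, GaussianClosure P G (y i) (h i)) :
    GaussianClosure P G (∑ i ∈ s, y i) (∑ i ∈ s, h i) := by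
  classical
  induction s using Finset.induction_on with
  | empty => simpa using zero
  | insert a s ha ih =>
    rw [Finset.sum_insert ha, Finset.sum_insert ha]
    exact (hy a (by simp)).add (ih fun i hi => hy i (by simp [hi]))

variable (hG : ∀ p ∈ G, HasLaw p.1 (gaussianReal 0 (‖p.2‖₊ ^ 2)) P)
include hG

lemma hasLaw (hy : GaussianClosure P G y h) : HasLaw y (gaussianReal 0 (‖h‖₊ ^ 2)) P := by
  induction hy with
  | base y h hmem => exact hG _ hmem
  | lim y h z k _ hy hh ih =>
    exact hasLaw_gaussianReal_of_tendsto ih (hh.nnnorm.pow 2) hy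

lemma memLp_two (hy : GaussianClosure P G y h) : MemLp y 2 P :=
  (hy.hasLaw hG).hasGaussianLaw.memLp_two

lemma integral_eq_zero (hy : GaussianClosure P G y h) : P[y] = 0 := by
  rw [(hy.hasLaw hG).integral_eq]; simp

lemma variance_eq (hy : GaussianClosure P G y h) : Var[y; P] = ‖h‖ ^ 2 := by
  rw [(hy.hasLaw hG).variance_eq, variance_id_gaussianReal]; simp

/-- Polarization: the sum of two matched pairs is matched, so its variance is known as well. -/
lemma covariance_eq (hy : GaussianClosure P G y h) (hz : GaussianClosure P G z k) :
    cov[y, z; P] = inner ℝ h k := by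
  have h1 := variance_add (hy.memLp_two hG) (hz.memLp_two hG)
  rw [(hy.add hz).variance_eq hG, hy.variance_eq hG, hz.variance_eq hG,
    norm_add_sq_real] at h1
  linarith

/-- Cramér–Wold: every linear functional of finitely many coordinates is again a matched variable,
hence normal. -/
lemma isGaussianProcess {T : Type*} {Y : T → Ω → ℝ} {φ : T → H}
    (hY : ∀ t, GaussianClosure P G (Y t) (φ t)) : IsGaussianProcess Y P where
  hasGaussianLaw I := by
    classical
    have hmeas : AEMeasurable (fun ω => I.restrict (Y · ω)) P :=
      aemeasurable_pi_lambda _ fun i => ((hY i).hasLaw hG).aemeasurable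
    refine ⟨isGaussian_of_map_eq_gaussianReal fun L => ?_⟩
    rw [AEMeasurable.map_map_of_aemeasurable (by fun_prop) hmeas]
    have h1 : (L ∘ fun ω => I.restrict (Y · ω))
        = ∑ i : I, (L (Pi.single i 1)) • Y i := by
      ext ω
      simp only [Function.comp_apply, Finset.sum_apply, Pi.smul_apply, smul_eq_mul]
      conv_lhs => rw [← Finset.univ_sum_single (I.restrict (Y · ω)), map_sum]
      refine Finset.sum_congr rfl fun i _ => ?_
      have : Pi.single i (I.restrict (Y · ω) i) = Y i ω • (Pi.single i 1 : I → ℝ) := by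
        rw [← Pi.single_smul]; simp
      rw [this, map_smul, smul_eq_mul, mul_comm]
    rw [h1]
    exact ⟨_, _, ((sum (Finset.univ : Finset I) fun i _ => (hY i).smul (L (Pi.single i 1))).hasLaw hG).map_eq⟩

end GaussianClosure

/-- A linear combination of a centered Gaussian process is Gaussian, with variance the squared
norm of the corresponding combination of vectors. -/
lemma hasLaw_of_mem_span {T : Type*} {X : T → Ω → ℝ} {φ : T → H} (hX : IsGaussianProcess X P)
    (hX0 : ∀ t, P[X t] = 0) (hcov : ∀ s t, cov[X s, X t; P] = inner ℝ (φ s) (φ t)) :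
    ∀ p ∈ Submodule.span ℝ (range fun t => (X t, φ t)),
      HasLaw p.1 (gaussianReal 0 (‖p.2‖₊ ^ 2)) P := by
  classical
  intro p hp
  obtain ⟨c, rfl⟩ := Finsupp.mem_span_range_iff_exists_finsupp.1 hp
  have h1 : (c.sum fun i a => a • (X i, φ i)).1 = fun ω => ∑ i ∈ c.support, c i * X i ω := by
    ext ω; simp [Finsupp.sum, Prod.fst_sum]
  have h2 : (c.sum fun i a => a • (X i, φ i)).2 = ∑ i ∈ c.support, c i • φ i := by
    simp [Finsupp.sum, Prod.snd_sum]
  rw [h1, h2]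
  have hL (i : T) : MemLp (X i) 2 P := (hX.hasGaussianLaw_eval i).memLp_two
  have hg : HasGaussianLaw (fun ω => ∑ i ∈ c.support, c i * X i ω) P :=
    (hX.smul fun i => c i).hasGaussianLaw_fun_sum
  refine ⟨hg.aemeasurable, ?_⟩
  rw [hg.map_eq_gaussianReal]
  congr 1
  · rw [integral_finsetSum _ fun i _ => ((hL i).integrable (by norm_num)).const_mul _]
    simp [integral_const_mul, hX0]
  · rw [← Real.toNNReal_coe (r := ‖∑ i ∈ c.support, c i • φ i‖₊ ^ 2)]
    congr 1
    rw [NNReal.coe_pow, coe_nnnorm, ← real_inner_self_eq_norm_sq, sum_inner,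
      variance_fun_sum' fun i _ => (hL i).const_mul _]
    refine Finset.sum_congr rfl fun i _ => ?_
    rw [inner_sum]
    refine Finset.sum_congr rfl fun j _ => ?_
    rw [covariance_const_mul_left, covariance_const_mul_right, hcov, real_inner_smul_left,
      real_inner_smul_right]

end GaussianClosure

/-! ### Maximal inequality and almost sure convergence for independent increments. -/

section Maximal

variable {Ω : Type*} [MeasurableSpace Ω] {P : Measure Ω} [IsProbabilityMeasure P]

/-- The partial sums form a martingale S, so |S| = S ⊔ -S is a nonnegative submartingale and Doob's
maximal inequality applies. -/
lemma measure_exists_le_abs_sum_le_of_stronglyMeasurable {D : ℕ → Ω → ℝ}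
    (hm : ∀ i, StronglyMeasurable (D i))
    (hint : ∀ i, Integrable (D i) P) (h0 : ∀ i, P[D i] = 0) (hD : iIndepFun D P)
    {ε : ℝ} (hε : 0 < ε) (n : ℕ) :
    P {ω | ∃ k ≤ n, ε ≤ |∑ i ∈ Finset.range (k + 1), D i ω|}
      ≤ ENNReal.ofReal ((∫ ω, |∑ i ∈ Finset.range (n + 1), D i ω| ∂P) / ε) := by
  let S : ℕ → Ω → ℝ := fun k => ∑ i ∈ Finset.range (k + 1), D i
  have hSint (k : ℕ) : Integrable (S k) P :=
    integrable_finsetSum' _ fun i _ => hint i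
  have hS : Martingale S (Filtration.natural D hm) P := by
    refine martingale_of_condExp_sub_eq_zero_nat (fun k => ?_) hSint fun k => ?_
    · refine Finset.stronglyMeasurable_sum _ fun i hi => ?_
      exact (Filtration.stronglyAdapted_natural hm i).mono
        ((Filtration.natural D hm).mono (Nat.lt_succ_iff.1 (Finset.mem_range.1 hi)))
    · have : S (k + 1) - S k = D (k + 1) := by
        simp [S, Finset.sum_range_succ _ (k + 1)]
      rw [this]
      filter_upwards [hD.condExp_natural_ae_eq_of_lt hm (Nat.lt_succ_self k)] with ω hω
      rw [hω, h0, Pi.zero_apply]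
  have hsub : Submartingale (S ⊔ -S) (Filtration.natural D hm) P :=
    hS.submartingale.sup hS.neg.submartingale
  have habs (k : ℕ) (ω : Ω) : (S ⊔ -S) k ω = |∑ i ∈ Finset.range (k + 1), D i ω| := by
    simp [S, abs, Pi.sup_apply]
  have hmax := maximal_ineq hsub (ε := ε.toNNReal)
    (fun k ω => by rw [habs]; exact abs_nonneg _) n
  have hset : {ω | ∃ k ≤ n, ε ≤ |∑ i ∈ Finset.range (k + 1), D i ω|} ⊆
      {ω | (ε.toNNReal : ℝ) ≤ (Finset.range (n + 1)).sup' Finset.nonempty_range_add_one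
        fun k => (S ⊔ -S) k ω} := by
    rintro ω ⟨k, hk, h⟩
    simp only [mem_ofPred_eq, Real.coe_toNNReal ε hε.le, Finset.le_sup'_iff]
    exact ⟨k, by simpa [Nat.lt_succ_iff] using hk, by rwa [habs]⟩
  rw [ENNReal.ofReal_div_of_pos hε,
    ENNReal.le_div_iff_mul_le (Or.inl (by simpa using hε)) (Or.inl ENNReal.ofReal_ne_top), mul_comm]
  refine (mul_le_mul_right (measure_mono hset) _).trans (hmax.trans (ENNReal.ofReal_le_ofReal ?_))
  simp_rw [habs]
  exact setIntegral_le_integral (by simpa [S] using (hSint n).abs)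
    (Eventually.of_forall fun _ => abs_nonneg _)

/-- Maximal inequality for sums of independent centered variables. -/
lemma measure_exists_le_abs_sum_le {D : ℕ → Ω → ℝ}
    (hint : ∀ i, Integrable (D i) P) (h0 : ∀ i, P[D i] = 0) (hD : iIndepFun D P)
    {ε : ℝ} (hε : 0 < ε) (n : ℕ) :
    P {ω | ∃ k ≤ n, ε ≤ |∑ i ∈ Finset.range (k + 1), D i ω|}
      ≤ ENNReal.ofReal ((∫ ω, |∑ i ∈ Finset.range (n + 1), D i ω| ∂P) / ε) := by
  -- The natural filtration needs strongly measurable variables, so each one is replaced by an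
  -- almost surely equal version.
  let D' : ℕ → Ω → ℝ := fun i => (hint i).1.mk (D i)
  have hD' (i : ℕ) : D i =ᵐ[P] D' i := (hint i).1.ae_eq_mk
  have hall : ∀ᵐ ω ∂P, ∀ i, D i ω = D' i ω := ae_all_iff.2 hD'
  have h1 := measure_exists_le_abs_sum_le_of_stronglyMeasurable (D := D')
    (fun i => (hint i).1.stronglyMeasurable_mk) (fun i => (hint i).congr (hD' i))
    (fun i => by rw [← h0 i]; exact integral_congr_ae (hD' i).symm) (hD.congr hD') hε n
  have h2 : P {ω | ∃ k ≤ n, ε ≤ |∑ i ∈ Finset.range (k + 1), D i ω|}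
      = P {ω | ∃ k ≤ n, ε ≤ |∑ i ∈ Finset.range (k + 1), D' i ω|} := by
    refine measure_congr (eventuallyEq_set.2 ?_)
    filter_upwards [hall] with ω hω
    simp only [hω]
  have h3 : ∫ ω, |∑ i ∈ Finset.range (n + 1), D i ω| ∂P
      = ∫ ω, |∑ i ∈ Finset.range (n + 1), D' i ω| ∂P := by
    refine integral_congr_ae ?_
    filter_upwards [hall] with ω hω
    simp only [hω]
  rw [h2, h3]
  exact h1

variable {H : Type*} [NormedAddCommGroup H] [InnerProductSpace ℝ H]
  {G : Submodule ℝ ((Ω → ℝ) × H)} {N : ℝ → Ω → ℝ} {φ : ℝ → H}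

/-- The variance of |y| is nonnegative, so (E|y|)² ≤ E y² = ‖h‖². -/
lemma GaussianClosure.integral_abs_le (hG : ∀ p ∈ G, HasLaw p.1 (gaussianReal 0 (‖p.2‖₊ ^ 2)) P)
    {y : Ω → ℝ} {h : H} (hy : GaussianClosure P G y h) : ∫ ω, |y ω| ∂P ≤ ‖h‖ := by
  have h2 := hy.memLp_two hG
  have hv : Var[fun ω => |y ω|; P] = P[(fun ω => |y ω|) ^ 2] - (P[fun ω => |y ω|]) ^ 2 :=
    variance_eq_sub h2.abs
  have hv' := hy.variance_eq hG
  rw [variance_of_integral_eq_zero h2.aemeasurable (hy.integral_eq_zero hG)] at hv'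
  have : P[(fun ω => |y ω|) ^ 2] = ‖h‖ ^ 2 := by
    rw [← hv']; simp
  rw [this] at hv
  have := variance_nonneg (fun ω => |y ω|) P
  exact abs_le_of_sq_le_sq' (by linarith) (norm_nonneg _) |>.2

variable (hG : ∀ p ∈ G, HasLaw p.1 (gaussianReal 0 (‖p.2‖₊ ^ 2)) P)
  (hN : ∀ t, 0 ≤ t → GaussianClosure P G (N t) (φ t))
  (horth : ∀ a b c d, 0 ≤ a → a ≤ b → b ≤ c → c ≤ d → inner ℝ (φ b - φ a) (φ d - φ c) = 0)
include hG hN horth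

/-- Jointly Gaussian variables with vanishing covariances are independent. -/
lemma iIndepFun_increments {t : ℕ → ℝ} (ht : Monotone t) (ht0 : 0 ≤ t 0) :
    iIndepFun (fun i => N (t (i + 1)) - N (t i)) P := by
  have ht0' (i : ℕ) : 0 ≤ t i := ht0.trans (ht (Nat.zero_le i))
  have hD (i : ℕ) : GaussianClosure P G (N (t (i + 1)) - N (t i)) (φ (t (i + 1)) - φ (t i)) :=
    (hN _ (ht0' _)).sub (hN _ (ht0' _))
  rw [iIndepFun_iff_finset]
  intro s
  refine ((GaussianClosure.isGaussianProcess hG hD).hasGaussianLaw s).iIndepFun_of_covariance_eq_zero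
    fun i j hij => ?_
  change cov[N (t (i + 1)) - N (t i), N (t (j + 1)) - N (t j); P] = 0
  rw [(hD i).covariance_eq hG (hD j)]
  rcases lt_or_gt_of_ne (fun h => hij (Subtype.ext h)) with h | h
  · exact horth _ _ _ _ (ht0' _) (ht (by omega)) (ht h) (ht (by omega))
  · rw [real_inner_comm]
    exact horth _ _ _ _ (ht0' _) (ht (by omega)) (ht h) (ht (by omega))

lemma measure_exists_le_abs_sub_le {t : ℕ → ℝ} (ht : Monotone t) (ht0 : 0 ≤ t 0)
    {ε : ℝ} (hε : 0 < ε) (n : ℕ) :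
    P {ω | ∃ k ≤ n, ε ≤ |N (t (k + 1)) ω - N (t 0) ω|}
      ≤ ENNReal.ofReal (‖φ (t (n + 1)) - φ (t 0)‖ / ε) := by
  have ht0' (i : ℕ) : 0 ≤ t i := ht0.trans (ht (Nat.zero_le i))
  have hD (i j : ℕ) : GaussianClosure P G (N (t i) - N (t j)) (φ (t i) - φ (t j)) :=
    (hN _ (ht0' _)).sub (hN _ (ht0' _))
  have h1 := measure_exists_le_abs_sum_le
    (fun i => ((hD (i + 1) i).memLp_two hG).integrable (by norm_num))
    (fun i => (hD (i + 1) i).integral_eq_zero hG) (iIndepFun_increments hG hN horth ht ht0) hε n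
  have h2 (k : ℕ) (ω : Ω) : ∑ i ∈ Finset.range (k + 1), (N (t (i + 1)) - N (t i)) ω
      = N (t (k + 1)) ω - N (t 0) ω := by
    simpa using Finset.sum_range_sub (fun i => N (t i) ω) (k + 1)
  simp_rw [h2] at h1
  exact h1.trans (ENNReal.ofReal_le_ofReal (by gcongr; exact (hD (n + 1) 0).integral_abs_le hG))

/-- The discrete bound holds on each grid with the same right side. By continuity, a strict excess
over ε at some time is seen by all sufficiently fine and long grids, so the event lies in the lower
limit of the grid events. -/
lemma measure_exists_lt_abs_sub_le {T δ ε : ℝ} (hT : 0 ≤ T) (hε : 0 < ε)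
    (hcont : ∀ᵐ ω ∂P, ContinuousOn (fun t => N t ω) (Ici 0))
    (hδ : ∀ t, T ≤ t → ‖φ t - φ T‖ ≤ δ) :
    P {ω | ∃ t, T ≤ t ∧ ε < |N t ω - N T ω|} ≤ ENNReal.ofReal (δ / ε) := by
  let s : ℕ → ℕ → ℝ := fun m k => T + k / (m + 1 : ℝ)
  have hs0 (m : ℕ) : s m 0 = T := by simp [s]
  have hs (m : ℕ) : Monotone (s m) := fun i j hij => by
    simp only [s]
    gcongr
  let E : ℕ → Set Ω := fun m => {ω | ∃ k ≤ m * (m + 1), ε ≤ |N (s m (k + 1)) ω - N (s m 0) ω|}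
  have hE (m : ℕ) : P (E m) ≤ ENNReal.ofReal (δ / ε) := by
    refine (measure_exists_le_abs_sub_le hG hN horth (hs m) (by rwa [hs0]) hε _).trans
      (ENNReal.ofReal_le_ofReal ?_)
    gcongr
    rw [hs0]
    exact hδ _ (by rw [← hs0 m]; exact hs m (Nat.zero_le _))
  have hsub : ∀ᵐ ω ∂P, ω ∈ {ω | ∃ t, T ≤ t ∧ ε < |N t ω - N T ω|} →
      ω ∈ ⋃ M : ℕ, ⋂ m ≥ M, E m := by
    filter_upwards [hcont] with ω hω
    rintro ⟨t, hTt, ht⟩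
    rw [mem_iUnion]
    -- The grid point just to the right of t is used, because the discrete bound covers the indices
    -- k + 1.
    have hlim : Tendsto (fun m : ℕ => s m (⌊(t - T) * (m + 1)⌋₊ + 1)) atTop (𝓝[Ici 0] t) := by
      refine tendsto_nhdsWithin_iff.2 ⟨?_, Eventually.of_forall fun m => ?_⟩
      · have h1 : Tendsto (fun m : ℕ => t + 1 / ((m : ℝ) + 1)) atTop (𝓝 t) := by
          simpa using tendsto_one_div_add_atTop_nhds_zero_nat.const_add t
        refine tendsto_of_tendsto_of_tendsto_of_le_of_le tendsto_const_nhds h1 (fun m => ?_)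
          fun m => ?_
        · have hm : (0 : ℝ) < m + 1 := by positivity
          have := Nat.lt_floor_add_one ((t - T) * (m + 1))
          simp only [s, Nat.cast_add, Nat.cast_one]
          rw [← sub_le_iff_le_add', le_div_iff₀ hm]
          exact this.le
        · have hm : (0 : ℝ) < m + 1 := by positivity
          have := Nat.floor_le (a := (t - T) * (m + 1)) (mul_nonneg (by linarith) hm.le)
          simp only [s, Nat.cast_add, Nat.cast_one]
          rw [add_div]
          have : (⌊(t - T) * (m + 1)⌋₊ : ℝ) / (m + 1) ≤ t - T := by rwa [div_le_iff₀ hm]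
          linarith
      · exact hT.trans (by rw [← hs0 m]; exact hs m (Nat.zero_le _))
    have hev := (((hω t (hT.trans hTt)).tendsto.comp hlim).sub_const (N T ω)).abs.eventually_const_lt ht
    have hfl : ∀ᶠ m : ℕ in atTop, t - T ≤ m :=
      tendsto_natCast_atTop_atTop.eventually_ge_atTop _
    obtain ⟨M, hM⟩ := eventually_atTop.1 (hev.and hfl)
    refine ⟨M, mem_iInter₂.2 fun m hm => ⟨⌊(t - T) * (m + 1)⌋₊, ?_, ?_⟩⟩
    · refine Nat.floor_le_of_le ?_
      push_cast
      have := (hM m hm).2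
      gcongr
    · rw [hs0]
      exact (hM m hm).1.le
  refine (measure_mono_ae (t := ⋃ M : ℕ, ⋂ m ≥ M, E m) hsub).trans ?_
  rw [Monotone.measure_iUnion]
  · exact iSup_le fun M => (measure_mono (iInter₂_subset M le_rfl)).trans (hE M)
  · intro i j hij
    exact biInter_subset_biInter_left fun m (hm : m ≥ j) => hij.trans hm

/-- A Gaussian process with continuous paths and orthogonal increments converges almost surely at
infinity as soon as it converges in mean square. -/
lemma ae_exists_tendsto_atTop {k : H}
    (hcont : ∀ᵐ ω ∂P, ContinuousOn (fun t => N t ω) (Ici 0))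
    (hφ : Tendsto φ atTop (𝓝 k)) :
    ∀ᵐ ω ∂P, ∃ l, Tendsto (fun t => N t ω) atTop (𝓝 l) := by
  have hnull (ε : ℝ) (hε : 0 < ε) :
      ∀ᵐ ω ∂P, ∃ T : ℝ, ∀ t, T ≤ t → |N t ω - N T ω| ≤ ε := by
    rw [ae_iff]
    refine le_antisymm (ENNReal.le_of_forall_pos_le_add fun η hη _ => ?_) zero_le
    have hηε : 0 < η * ε / 2 := by positivity
    obtain ⟨T, hT⟩ := eventually_atTop.1 ((hφ.eventually
      (Metric.ball_mem_nhds k hηε)).and (eventually_ge_atTop 0))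
    have hT0 := (hT T le_rfl).2
    have hb := measure_exists_lt_abs_sub_le hG hN horth (δ := η * ε) hT0 hε hcont fun t ht => by
      have h1 := (hT t ht).1
      have h2 := (hT T le_rfl).1
      rw [dist_eq_norm] at h1 h2
      calc ‖φ t - φ T‖ = ‖(φ t - k) - (φ T - k)‖ := by congr 1; abel
        _ ≤ ‖φ t - k‖ + ‖φ T - k‖ := norm_sub_le _ _
        _ ≤ η * ε := by linarith
    rw [mul_div_cancel_right₀ _ hε.ne', ENNReal.ofReal_coe_nnreal] at hb
    rw [zero_add]
    refine (measure_mono fun ω hω => ?_).trans hb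
    simp only [mem_ofPred_eq, not_exists, not_forall, not_le] at hω ⊢
    obtain ⟨t, ht, h⟩ := hω T
    exact ⟨t, ht, h⟩
  have hall : ∀ᵐ ω ∂P, ∀ n : ℕ, ∃ T : ℝ, ∀ t, T ≤ t → |N t ω - N T ω| ≤ 1 / ((n : ℝ) + 1) :=
    ae_all_iff.2 fun n => hnull _ (by positivity)
  filter_upwards [hall] with ω hω
  refine cauchy_map_iff_exists_tendsto.1 (Metric.cauchy_iff.2 ⟨inferInstance, fun ε hε => ?_⟩)
  obtain ⟨n, hn⟩ := exists_nat_one_div_lt (half_pos hε)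
  obtain ⟨T, hT⟩ := hω n
  refine ⟨_, image_mem_map (Ici_mem_atTop T), ?_⟩
  rintro _ ⟨s, hs, rfl⟩ _ ⟨t, ht, rfl⟩
  have h1 := abs_le.1 (hT s hs)
  have h2 := abs_le.1 (hT t ht)
  rw [Real.dist_eq, abs_lt]
  constructor <;> linarith

end Maximal

/-! ### Inner products and dominated convergence in L². -/

section Lp

variable {α : Type*} [MeasurableSpace α] {ν : Measure α}

lemma inner_toLp {f g : α → ℝ} (hf : MemLp f 2 ν) (hg : MemLp g 2 ν) :
    inner ℝ (hf.toLp f) (hg.toLp g) = ∫ x, f x * g x ∂ν := by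
  rw [L2.inner_def]
  refine integral_congr_ae ?_
  filter_upwards [hf.coeFn_toLp, hg.coeFn_toLp] with x h1 h2
  rw [h1, h2]
  simp [mul_comm]

lemma norm_toLp_sq {f : α → ℝ} (hf : MemLp f 2 ν) : ‖hf.toLp f‖ ^ 2 = ∫ x, f x ^ 2 ∂ν := by
  rw [← real_inner_self_eq_norm_sq, inner_toLp]
  simp_rw [sq]

/-- Dominated convergence in `L²`. -/
lemma tendsto_toLp_of_dominated {ι : Type*} {l : Filter ι} [l.IsCountablyGenerated]
    {f : ι → α → ℝ} {g b : α → ℝ} (hf : ∀ i, MemLp (f i) 2 ν) (hg : MemLp g 2 ν)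
    (hb : MemLp b 2 ν) (hfb : ∀ᶠ i in l, ∀ᵐ x ∂ν, |f i x| ≤ b x) (hgb : ∀ᵐ x ∂ν, |g x| ≤ b x)
    (hlim : ∀ᵐ x ∂ν, Tendsto (fun i => f i x) l (𝓝 (g x))) :
    Tendsto (fun i => (hf i).toLp (f i)) l (𝓝 (hg.toLp g)) := by
  rw [tendsto_iff_norm_sub_tendsto_zero]
  have h1 (i : ι) : ‖(hf i).toLp (f i) - hg.toLp g‖ = √(∫ x, (f i x - g x) ^ 2 ∂ν) := by
    rw [← MemLp.toLp_sub, ← Real.sqrt_sq (norm_nonneg _), norm_toLp_sq]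
    rfl
  simp_rw [h1]
  rw [← Real.sqrt_zero]
  refine (Real.continuous_sqrt.tendsto 0).comp ?_
  have h2 : (0 : ℝ) = ∫ _, 0 ∂ν := by simp
  rw [h2]
  refine tendsto_integral_filter_of_dominated_convergence (fun x => (2 * b x) ^ 2)
    (Eventually.of_forall fun i => (((hf i).sub hg).1.pow 2)) ?_
    ((hb.const_mul 2).integrable_sq) ?_
  · filter_upwards [hfb] with i hi
    filter_upwards [hi, hgb] with x h3 h4
    rw [Real.norm_eq_abs, abs_of_nonneg (sq_nonneg _), sq_le_sq]
    calc |f i x - g x| ≤ |f i x| + |g x| := abs_sub _ _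
      _ ≤ 2 * b x := by linarith
      _ ≤ |2 * b x| := le_abs_self _
  · filter_upwards [hlim] with x hx
    simpa using ((hx.sub_const (g x)).pow 2)

end Lp

/-! ### Riemann sums. -/

section Riemann

/-- Turns a Riemann sum into the integral of g composed with rounding down to the grid, so that
dominated convergence can be used. -/
lemma integral_comp_floor (g : ℝ → ℝ) {d : ℝ} (hd : 0 < d) (n : ℕ) :
    ∫ t in (0 : ℝ)..(n * d), g (d * ⌊t / d⌋₊) = ∑ k ∈ Finset.range n, d * g (k * d) := by
  have hev (k : ℕ) : ∀ t ∈ Ioo (k * d) ((k + 1 : ℕ) * d), g (d * ⌊t / d⌋₊) = g (k * d) := by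
    intro t ht
    have : ⌊t / d⌋₊ = k := by
      rw [Nat.floor_eq_iff (div_nonneg ((by positivity : (0 : ℝ) ≤ k * d).trans ht.1.le) hd.le),
        le_div_iff₀ hd, div_lt_iff₀ hd]
      exact ⟨ht.1.le, by simpa using ht.2⟩
    rw [this, mul_comm]
  have hle (k : ℕ) : (k : ℝ) * d ≤ (k + 1 : ℕ) * d := by gcongr; simp
  have hadj := intervalIntegral.sum_integral_adjacent_intervals (μ := volume)
    (f := fun t => g (d * ⌊t / d⌋₊)) (a := fun k : ℕ => (k : ℝ) * d) (n := n) fun k _ => by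
      rw [intervalIntegrable_iff_integrableOn_Ioo_of_le (hle k)]
      exact (integrableOn_const (by simp)).congr_fun (fun t ht => (hev k t ht).symm)
        measurableSet_Ioo
  simp only [Nat.cast_zero, zero_mul] at hadj
  rw [← hadj]
  refine Finset.sum_congr rfl fun k _ => ?_
  rw [intervalIntegral.integral_of_le (hle k), integral_Ioc_eq_integral_Ioo,
    setIntegral_congr_fun measurableSet_Ioo (hev k), setIntegral_const]
  simp [add_mul, hd.le]

/-- Riemann sums of a bounded, almost everywhere continuous function converge. -/
lemma tendsto_riemannSum {g : ℝ → ℝ} (hg : Measurable g) {C T : ℝ} (hT : 0 ≤ T)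
    (hC : ∀ t ∈ Icc 0 T, |g t| ≤ C)
    (hcont : ∀ᵐ t : ℝ, ContinuousAt g t) :
    Tendsto (fun n : ℕ => ∑ k ∈ Finset.range (n + 1), T / (n + 1) * g (k * (T / (n + 1)))) atTop
      (𝓝 (∫ t in (0 : ℝ)..T, g t)) := by
  rcases hT.eq_or_lt with rfl | hT
  · simp
  have hd (n : ℕ) : 0 < T / (n + 1) := by positivity
  have h1 (n : ℕ) : ∑ k ∈ Finset.range (n + 1), T / (n + 1) * g (k * (T / (n + 1)))
      = ∫ t in (0 : ℝ)..T, g (T / (n + 1) * ⌊t / (T / (n + 1))⌋₊) := by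
    rw [← integral_comp_floor g (hd n) (n + 1)]
    congr 1
    push_cast
    field_simp
  simp_rw [h1]
  have hfl (n : ℕ) (t : ℝ) (ht : 0 ≤ t) : T / (n + 1) * ⌊t / (T / (n + 1))⌋₊ ≤ t := by
    have := Nat.floor_le (div_nonneg ht (hd n).le)
    rwa [le_div_iff₀' (hd n)] at this
  refine intervalIntegral.tendsto_integral_filter_of_dominated_convergence (fun _ => C)
    (Eventually.of_forall fun n => ?_) (Eventually.of_forall fun n => ?_) (by simp) ?_
  · refine (hg.comp ?_).aestronglyMeasurable
    fun_prop
  · refine Eventually.of_forall fun t ht => ?_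
    rw [uIoc_of_le hT.le] at ht
    exact hC _ ⟨mul_nonneg (hd n).le (Nat.cast_nonneg _), (hfl n t ht.1.le).trans ht.2⟩
  · filter_upwards [hcont] with t hct ht
    rw [uIoc_of_le hT.le] at ht
    refine hct.tendsto.comp ?_
    have h2 : Tendsto (fun n : ℕ => t - T * (1 / ((n : ℝ) + 1))) atTop (𝓝 t) := by
      simpa using (tendsto_one_div_add_atTop_nhds_zero_nat.const_mul T).const_sub t
    refine tendsto_of_tendsto_of_tendsto_of_le_of_le h2 tendsto_const_nhds (fun n => ?_)
      fun n => hfl n t ht.1.le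
    have := Nat.lt_floor_add_one (t / (T / (n + 1)))
    rw [div_lt_iff₀' (hd n), mul_add] at this
    simp only [mul_one_div]
    linarith

end Riemann

/-! ### A continuous Kronecker lemma. -/

section Kronecker

/-- A continuous version of Kronecker's lemma: if `R` decreases to `0` with derivative `-S` and
`A' = S M`, then convergence of `A + R M` implies that of `A`, to the same limit. -/
lemma tendsto_of_tendsto_add_mul {A M R S : ℝ → ℝ} {l : ℝ}
    (hR : ∀ x, HasDerivAt R (-S x) x) (hRpos : ∀ x, 0 < R x) (hS : ∀ x, 0 ≤ S x)
    (hR0 : Tendsto R atTop (𝓝 0)) (hA : ∀ x, HasDerivAt A (S x * M x) x)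
    (hl : Tendsto (fun x => A x + R x * M x) atTop (𝓝 l)) : Tendsto A atTop (𝓝 l) := by
  -- 1 / R is an integrating factor: the sign of A + R M - c decides whether (A - c) / R increases
  -- or decreases.
  have hD (c : ℝ) (x : ℝ) : HasDerivAt (fun x => (A x - c) / R x)
      (S x / R x ^ 2 * (A x + R x * M x - c)) x := by
    refine (((hA x).sub_const c).div (hR x) (hRpos x).ne').congr_deriv ?_
    field_simp
    ring
  rw [Metric.tendsto_atTop]
  intro ε hε
  obtain ⟨T, hT⟩ := Metric.tendsto_atTop.1 hl (ε / 2) (half_pos hε)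
  have hmono (c : ℝ) (hc : ∀ x, T ≤ x → 0 ≤ A x + R x * M x - c) :
      MonotoneOn (fun x => (A x - c) / R x) (Ici T) := by
    refine monotoneOn_of_deriv_nonneg (convex_Ici T)
      (fun x _ => (hD c x).continuousAt.continuousWithinAt)
      (fun x _ => (hD c x).differentiableAt.differentiableWithinAt) fun x hx => ?_
    rw [(hD c x).deriv]
    rw [interior_Ici] at hx
    have := hc x (le_of_lt hx)
    have := hS x
    positivity
  have hanti (c : ℝ) (hc : ∀ x, T ≤ x → A x + R x * M x - c ≤ 0) :
      AntitoneOn (fun x => (A x - c) / R x) (Ici T) := by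
    refine antitoneOn_of_deriv_nonpos (convex_Ici T)
      (fun x _ => (hD c x).continuousAt.continuousWithinAt)
      (fun x _ => (hD c x).differentiableAt.differentiableWithinAt) fun x hx => ?_
    rw [(hD c x).deriv]
    rw [interior_Ici] at hx
    have := hS x
    exact mul_nonpos_of_nonneg_of_nonpos (by positivity) (hc x (le_of_lt hx))
  -- Monotonicity from T on bounds A(x) from below by l - ε/2 plus a constant times R(x), and the
  -- next bound is symmetric; both corrections vanish because R → 0.
  have hlow := hmono (l - ε / 2) fun x hx => by
    have := abs_lt.1 (by simpa [Real.dist_eq] using hT x hx)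
    linarith
  have hupp := hanti (l + ε / 2) fun x hx => by
    have := abs_lt.1 (by simpa [Real.dist_eq] using hT x hx)
    linarith
  have hsmall (c : ℝ) : ∀ᶠ x in atTop, |R x * c| < ε / 2 := by
    have := (hR0.mul_const c).abs
    rw [zero_mul, abs_zero] at this
    exact this.eventually_lt_const (half_pos hε)
  obtain ⟨T', hT'⟩ := eventually_atTop.1 (((hsmall ((A T - (l - ε / 2)) / R T)).and
    (hsmall ((A T - (l + ε / 2)) / R T))).and (eventually_ge_atTop T))
  refine ⟨T', fun x hx => ?_⟩
  obtain ⟨⟨h1, h2⟩, h3⟩ := hT' x hx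
  have h4 := hlow (self_mem_Ici) h3 h3
  have h5 := hupp (self_mem_Ici) h3 h3
  simp only at h4 h5
  rw [le_div_iff₀' (hRpos x)] at h4
  rw [div_le_iff₀' (hRpos x)] at h5
  rw [Real.dist_eq, abs_lt]
  rw [abs_lt] at h1 h2
  constructor <;> linarith

end Kronecker

/-! ### Influence functions of the mean residual life and of the bridge in L². -/

section Feature

variable {μ : Measure ℝ} [IsProbabilityMeasure μ]

/-- The influence function `1_{y > x} (y - x - e(x))` of the mean residual life at `x`. -/
noncomputable def mrlFun (μ : Measure ℝ) (x y : ℝ) : ℝ :=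
  (Ioi x).indicator (fun y => y - x - meanResidualLife μ x) y

lemma mrlFun_of_lt {x y : ℝ} (h : x < y) : mrlFun μ x y = y - x - meanResidualLife μ x :=
  indicator_of_mem (s := Ioi x) h _

lemma mrlFun_of_le {x y : ℝ} (h : y ≤ x) : mrlFun μ x y = 0 :=
  indicator_of_notMem (s := Ioi x) (not_lt.2 h) _

lemma mrlFun_eq (x y : ℝ) :
    mrlFun μ x y = max (y - x) 0 - meanResidualLife μ x * (Ioi x).indicator 1 y := by
  rcases lt_or_ge x y with h | h
  · rw [mrlFun_of_lt h, max_eq_left (by linarith), indicator_of_mem (s := Ioi x) h]; simp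
  · rw [mrlFun_of_le h, max_eq_right (by linarith), indicator_of_notMem (s := Ioi x) (not_lt.2 h)]
    simp

lemma memLp_posPart (h : IsLifeLaw μ) (x : ℝ) : MemLp (fun y => max (y - x) 0) 2 μ :=
  (h.memLp_two.sub (memLp_const x)).pos_part

lemma memLp_mrlFun (h : IsLifeLaw μ) (x : ℝ) : MemLp (mrlFun μ x) 2 μ :=
  ((h.memLp_two.sub (memLp_const x)).sub (memLp_const _)).indicator measurableSet_Ioi

lemma integral_mrlFun (h : IsLifeLaw μ) (x : ℝ) : ∫ y, mrlFun μ x y ∂μ = 0 := by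
  have hi : Integrable ((Ioi x).indicator (1 : ℝ → ℝ)) μ :=
    (integrable_const (1 : ℝ)).indicator measurableSet_Ioi
  simp_rw [mrlFun_eq]
  rw [integral_sub (h.integrable_posPart x) (hi.const_mul _), integral_const_mul, integral_indicator_one measurableSet_Ioi, ← survival_eq_measureReal,
    h.meanResidualLife_mul_survival, h.excess_eq_integral, sub_self]

/-- The influence function as an element of `L²`. -/
noncomputable def mrlVec (h : IsLifeLaw μ) (x : ℝ) : Lp ℝ 2 μ := (memLp_mrlFun h x).toLp _

/-- Where the function indexed by y is nonzero, the two influence functions differ by a constant,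
and the one indexed by y has mean zero. -/
lemma inner_mrlVec (h : IsLifeLaw μ) {x y : ℝ} (hxy : x ≤ y) :
    inner ℝ (mrlVec h x) (mrlVec h y) = ‖mrlVec h y‖ ^ 2 := by
  have hi : Integrable (fun z => mrlFun μ x z * mrlFun μ y z) μ :=
    (memLp_mrlFun h x).integrable_mul (memLp_mrlFun h y)
  rw [mrlVec, mrlVec, inner_toLp, norm_toLp_sq, ← sub_eq_zero,
    ← integral_sub hi (memLp_mrlFun h y).integrable_sq]
  rw [← mul_zero (y + meanResidualLife μ y - x - meanResidualLife μ x), ← integral_mrlFun h y,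
    ← integral_const_mul]
  congr 1 with z
  rcases lt_or_ge y z with hz | hz
  · rw [mrlFun_of_lt hz, mrlFun_of_lt (hxy.trans_lt hz)]; ring
  · simp [mrlFun_of_le hz]

lemma inner_mrlVec_sub (h : IsLifeLaw μ) {a b c d : ℝ} (hab : a ≤ b) (hbc : b ≤ c) (hcd : c ≤ d) :
    inner ℝ (mrlVec h b - mrlVec h a) (mrlVec h d - mrlVec h c) = 0 := by
  simp only [inner_sub_left, inner_sub_right, inner_mrlVec h hbc, inner_mrlVec h (hab.trans hbc),
    inner_mrlVec h (hbc.trans hcd), inner_mrlVec h (hab.trans (hbc.trans hcd))]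
  ring

lemma norm_mrlVec_zero_sq (h : IsLifeLaw μ) : ‖mrlVec h 0‖ ^ 2 = Var[id; μ] := by
  rw [mrlVec, norm_toLp_sq, variance_eq_integral h.memLp_two.aemeasurable]
  refine integral_congr_ae ?_
  filter_upwards [h.ae_pos] with y hy
  rw [mrlFun_of_lt hy, meanResidualLife_eq, h.excess_zero, survival, h.cdf_of_nonpos le_rfl]
  simp

lemma norm_mrlVec_sub_sq (h : IsLifeLaw μ) {x y : ℝ} (hxy : x ≤ y) :
    ‖mrlVec h x - mrlVec h y‖ ^ 2 = ‖mrlVec h x‖ ^ 2 - ‖mrlVec h y‖ ^ 2 := by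
  rw [norm_sub_sq_real, inner_mrlVec h hxy]; ring

/-- Equality would force y - x - e(x) to vanish almost everywhere on an interval of positive mass,
whereas it vanishes at one point only, which is not an atom. -/
lemma norm_mrlVec_sq_strictAntiOn (h : IsLifeLaw μ) :
    StrictAntiOn (fun x => ‖mrlVec h x‖ ^ 2) (Ici 0) := by
  intro x hx y _ hxy
  rw [← sub_pos, ← norm_mrlVec_sub_sq h hxy.le]
  refine pow_pos (norm_pos_iff.2 fun h0 => ?_) 2
  rw [sub_eq_zero, mrlVec, mrlVec, MemLp.toLp_eq_toLp_iff] at h0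
  refine h.measure_Ioc_ne_zero x y hx hxy ?_
  rw [measure_eq_zero_iff_ae_notMem]
  have h1 : ∀ᵐ z ∂μ, z ≠ x + meanResidualLife μ x := by
    rw [ae_iff]
    simpa using! h.measure_singleton _
  filter_upwards [h0, h1] with z hz hz1 hmem
  rw [mrlFun_of_lt hmem.1, mrlFun_of_le hmem.2] at hz
  exact hz1 (by linarith)

lemma continuous_mrlVec (h : IsLifeLaw μ) : Continuous (mrlVec h) := by
  rw [continuous_iff_continuousAt]
  intro x
  have hC : ∀ᶠ x' in 𝓝 x, |x' + meanResidualLife μ x'| < |x + meanResidualLife μ x| + 1 :=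
    (continuous_id.add h.continuous_meanResidualLife).abs.continuousAt.eventually_lt_const
      (lt_add_one _)
  have hb : ∀ x', |x' + meanResidualLife μ x'| < |x + meanResidualLife μ x| + 1 →
      ∀ y, |mrlFun μ x' y| ≤ |y| + (|x + meanResidualLife μ x| + 1) := by
    intro x' hx' y
    rcases lt_or_ge x' y with hy | hy
    · rw [mrlFun_of_lt hy, sub_sub]
      exact (abs_sub _ _).trans (by linarith)
    · rw [mrlFun_of_le hy, abs_zero]; positivity
  refine tendsto_toLp_of_dominated (fun x' => memLp_mrlFun h x') (memLp_mrlFun h x)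
    (h.memLp_two.abs.add (memLp_const (|x + meanResidualLife μ x| + 1)))
    (hC.mono fun x' hx' => Eventually.of_forall (hb x' hx'))
    (Eventually.of_forall (hb x (lt_add_one _))) ?_
  have h1 : ∀ᵐ z ∂μ, z ≠ x := by
    rw [ae_iff]
    simpa using! h.measure_singleton x
  filter_upwards [h1] with y hy
  rcases lt_or_gt_of_ne hy with hy | hy
  · rw [mrlFun_of_le hy.le]
    refine tendsto_const_nhds.congr' ?_
    filter_upwards [lt_mem_nhds hy] with x' hx'
    rw [mrlFun_of_le hx'.le]
  · rw [mrlFun_of_lt hy]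
    have : Tendsto (fun x' => y - x' - meanResidualLife μ x') (𝓝 x)
        (𝓝 (y - x - meanResidualLife μ x)) :=
      (tendsto_id.const_sub y).sub h.continuous_meanResidualLife.continuousAt
    refine this.congr' ?_
    filter_upwards [gt_mem_nhds hy] with x' hx'
    rw [mrlFun_of_lt hx']

/-- The influence function is orthogonal to its own term e(x) 1_{y > x}. The bound is therefore free
of e(x), on which no control at infinity is available. -/
lemma norm_mrlVec_le (h : IsLifeLaw μ) (x : ℝ) :
    ‖mrlVec h x‖ ≤ ‖(memLp_posPart h x).toLp _‖ := by
  have h1 : ‖mrlVec h x‖ ^ 2 = inner ℝ (mrlVec h x) ((memLp_posPart h x).toLp _) := by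
    have hi : Integrable (fun y => mrlFun μ x y * max (y - x) 0) μ :=
      (memLp_mrlFun h x).integrable_mul (memLp_posPart h x)
    rw [mrlVec, norm_toLp_sq, inner_toLp, ← sub_eq_zero,
      ← integral_sub (memLp_mrlFun h x).integrable_sq hi]
    have h0 : ∫ y, -meanResidualLife μ x * mrlFun μ x y ∂μ = 0 := by
      rw [integral_const_mul, integral_mrlFun h x, mul_zero]
    refine Eq.trans ?_ h0
    congr 1 with y
    rcases lt_or_ge x y with hy | hy
    · rw [mrlFun_of_lt hy, max_eq_left (by linarith)]; ring
    · simp [mrlFun_of_le hy]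
  have h2 := real_inner_le_norm (mrlVec h x) ((memLp_posPart h x).toLp _)
  rw [← h1, sq] at h2
  rcases (norm_nonneg (mrlVec h x)).eq_or_lt with h0 | h0
  · rw [← h0]; exact norm_nonneg _
  · exact le_of_mul_le_mul_left h2 h0

lemma tendsto_mrlVec (h : IsLifeLaw μ) : Tendsto (mrlVec h) atTop (𝓝 0) := by
  refine squeeze_zero_norm (norm_mrlVec_le h) ?_
  have h1 : Tendsto (fun x => (memLp_posPart h x).toLp _) atTop
      (𝓝 ((MemLp.zero' : MemLp (fun _ : ℝ => (0 : ℝ)) 2 μ).toLp _)) := by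
    refine tendsto_toLp_of_dominated (b := fun y => |y|) _ _ h.memLp_two.abs ?_
      (Eventually.of_forall fun y => by simp) ?_
    · filter_upwards [eventually_ge_atTop 0] with x hx
      filter_upwards [h.ae_nonneg] with y hy
      rw [abs_of_nonneg (le_max_right _ _), abs_of_nonneg hy]
      exact max_le (by linarith) hy
    · refine Eventually.of_forall fun y => tendsto_const_nhds.congr' ?_
      filter_upwards [eventually_ge_atTop y] with x hx
      rw [max_eq_right (by linarith)]
  have h2 : (MemLp.zero' : MemLp (fun _ : ℝ => (0 : ℝ)) 2 μ).toLp _ = 0 := MemLp.toLp_zero _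
  rw [h2] at h1
  simpa using h1.norm

/-- The centered indicator `1_{y ≤ x} - F(x)`. -/
noncomputable def bridgeFun (μ : Measure ℝ) (x y : ℝ) : ℝ := (Iic x).indicator 1 y - cdf μ x

lemma memLp_bridgeFun (x : ℝ) : MemLp (bridgeFun μ x) 2 μ :=
  ((memLp_const (1 : ℝ)).indicator measurableSet_Iic).sub (memLp_const _)

noncomputable def bridgeVec (μ : Measure ℝ) [IsProbabilityMeasure μ] (x : ℝ) : Lp ℝ 2 μ :=
  (memLp_bridgeFun x).toLp _

lemma abs_bridgeFun_le (x y : ℝ) : |bridgeFun μ x y| ≤ 1 := by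
  have h1 := cdf_nonneg μ x
  have h2 := cdf_le_one μ x
  rw [bridgeFun, abs_le]
  by_cases h : y ∈ Iic x
  · rw [indicator_of_mem h, Pi.one_apply]; constructor <;> linarith
  · rw [indicator_of_notMem h]; constructor <;> linarith

/-- This is the covariance of a Brownian bridge at F(x) and F(y), which starts the isometry. -/
lemma inner_bridgeVec (x y : ℝ) : inner ℝ (bridgeVec μ x) (bridgeVec μ y)
    = min (cdf μ x) (cdf μ y) - cdf μ x * cdf μ y := by
  have hint (z : ℝ) : Integrable ((Iic z).indicator (1 : ℝ → ℝ)) μ :=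
    (integrable_const (1 : ℝ)).indicator measurableSet_Iic
  have hI (z : ℝ) : ∫ t, (Iic z).indicator (1 : ℝ → ℝ) t ∂μ = cdf μ z := by
    rw [integral_indicator_one measurableSet_Iic, cdf_eq_real]
  rw [bridgeVec, bridgeVec, inner_toLp]
  have h1 : (fun t => bridgeFun μ x t * bridgeFun μ y t) = fun t =>
      ((Iic (min x y)).indicator 1 t - cdf μ y * (Iic x).indicator 1 t
        - cdf μ x * (Iic y).indicator 1 t) + cdf μ x * cdf μ y := by
    ext t
    have : (Iic (min x y)).indicator (1 : ℝ → ℝ) t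
        = (Iic x).indicator 1 t * (Iic y).indicator 1 t := by
      rw [← Iic_inter_Iic, inter_indicator_one]; rfl
    rw [bridgeFun, bridgeFun, this]
    ring
  have h2 : Integrable (fun t => (Iic (min x y)).indicator (1 : ℝ → ℝ) t
      - cdf μ y * (Iic x).indicator 1 t) μ := (hint _).sub ((hint _).const_mul _)
  have h3 : Integrable (fun t => (Iic (min x y)).indicator (1 : ℝ → ℝ) t
      - cdf μ y * (Iic x).indicator 1 t - cdf μ x * (Iic y).indicator 1 t) μ :=
    h2.sub ((hint _).const_mul _)
  rw [h1, integral_add h3 (integrable_const _), integral_sub h2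
      ((hint _).const_mul _), integral_sub (hint _) ((hint _).const_mul _), integral_const_mul,
    integral_const_mul, hI, hI, hI, (monotone_cdf μ).map_min]
  simp
  ring

/-- The antiderivative of `t ↦ 1_{y ≤ t} - F(t)` vanishing at `0`. -/
noncomputable def bridgeIntegral (μ : Measure ℝ) (T y : ℝ) : ℝ :=
  ∫ t in (0 : ℝ)..T, bridgeFun μ t y

lemma integral_indicator_Iic {T y : ℝ} (hT : 0 ≤ T) (hy : 0 ≤ y) :
    ∫ t in (0 : ℝ)..T, (Iic t).indicator (1 : ℝ → ℝ) y = T - y + max (y - T) 0 := by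
  have h1 : (fun t => (Iic t).indicator (1 : ℝ → ℝ) y) = (Ici y).indicator 1 := by
    ext t; simp [indicator_apply]
  rw [h1, intervalIntegral.integral_of_le hT, ← integral_Icc_eq_integral_Ioc,
    integral_indicator_one measurableSet_Ici, measureReal_restrict_apply measurableSet_Ici,
    inter_comm, ← Ici_inter_Iic, inter_right_comm, Ici_inter_Ici, Ici_inter_Iic,
    Real.volume_real_Icc, sup_eq_right.2 hy]
  rcases le_total y T with h | h
  · rw [max_eq_left (by linarith), max_eq_right (by linarith)]; ring
  · rw [max_eq_right (by linarith), max_eq_left (by linarith)]; ring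

lemma measurable_bridgeFun (y : ℝ) : Measurable fun t => bridgeFun μ t y := by
  have h1 : (fun t => bridgeFun μ t y) = fun t => (Ici y).indicator (1 : ℝ → ℝ) t - cdf μ t := by
    ext t; simp [bridgeFun, indicator_apply]
  rw [h1]
  exact (measurable_one.indicator measurableSet_Ici).sub (monotone_cdf μ).measurable

lemma integral_cdf (h : IsLifeLaw μ) (T : ℝ) :
    ∫ t in (0 : ℝ)..T, cdf μ t = T - excess μ 0 + excess μ T := by
  have h1 := h.excess_sub 0 T
  simp only [survival] at h1
  rw [intervalIntegral.integral_sub (by simp) (h.continuous_cdf.intervalIntegrable _ _)] at h1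
  simp at h1
  linarith

/-- The deterministic shadow of the bridge transform: replacing U(F(t)) by 1_{y ≤ t} - F(t) gives an
increment of the influence function. Orthogonality of increments thus passes to the bridge. -/
lemma bridgeIntegral_add (h : IsLifeLaw μ) {T y : ℝ} (hT : 0 ≤ T) (hy : 0 < y) :
    bridgeIntegral μ T y + meanResidualLife μ T * bridgeFun μ T y
      = mrlFun μ T y - mrlFun μ 0 y := by
  have hint : IntervalIntegrable (fun t => (Iic t).indicator (1 : ℝ → ℝ) y) volume 0 T := by
    have h1 : (fun t => (Iic t).indicator (1 : ℝ → ℝ) y) = (Ici y).indicator 1 := by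
      ext t; simp [indicator_apply]
    rw [h1, intervalIntegrable_iff]
    exact (integrableOn_const (by simp)).indicator measurableSet_Ici
  simp only [bridgeIntegral, bridgeFun]
  rw [intervalIntegral.integral_sub hint (h.continuous_cdf.intervalIntegrable _ _),
    integral_indicator_Iic hT hy.le, integral_cdf h, mrlFun_eq, mrlFun_of_lt hy]
  have h0 : meanResidualLife μ 0 = excess μ 0 := by
    rw [meanResidualLife_eq, survival, h.cdf_of_nonpos le_rfl]; simp
  have h1 := h.meanResidualLife_mul_survival T
  rw [survival] at h1
  have h2 : (Iic T).indicator (1 : ℝ → ℝ) y = 1 - (Ioi T).indicator 1 y := by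
    rcases lt_or_ge T y with h | h
    · simp [h]
    · simp [h]
  rw [h0, h2]
  linear_combination h1

end Feature

lemma toLp_finsetSum {α ι : Type*} [MeasurableSpace α] {ν : Measure α} {s : Finset ι}
    {f : ι → α → ℝ} (hf : ∀ i, MemLp (f i) 2 ν) (hs : MemLp (fun x => ∑ i ∈ s, f i x) 2 ν) :
    hs.toLp _ = ∑ i ∈ s, (hf i).toLp _ := by
  classical
  induction s using Finset.induction_on with
  | empty => simpa using! MemLp.toLp_zero _
  | insert a s ha ih =>
    rw [Finset.sum_insert ha, ← ih (memLp_finsetSum _ fun i _ => hf i), ← MemLp.toLp_add,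
      MemLp.toLp_eq_toLp_iff]
    exact Eventually.of_forall fun x => Finset.sum_insert ha

/-! ### The limit process Z(1 - F) and its matching with influence functions. -/

section Limit

variable {Ω : Type*} [MeasurableSpace Ω] {P : Measure Ω} [IsProbabilityMeasure P]
  {μ : Measure ℝ} [IsProbabilityMeasure μ] {U : ℝ → Ω → ℝ}

lemma cdf_mem_Icc (x : ℝ) : cdf μ x ∈ Icc (0 : ℝ) 1 := ⟨cdf_nonneg μ x, cdf_le_one μ x⟩

/-- The span of the pairs (`U(F(x))`, centered indicator of `(-∞, x]`). -/
noncomputable def bridgeSpan (μ : Measure ℝ) [IsProbabilityMeasure μ] (U : ℝ → Ω → ℝ) :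
    Submodule ℝ ((Ω → ℝ) × Lp ℝ 2 μ) :=
  Submodule.span ℝ (range fun x => (U (cdf μ x), bridgeVec μ x))

lemma hasLaw_of_mem_bridgeSpan (hU : IsBrownianBridge U P) :
    ∀ p ∈ bridgeSpan μ U, HasLaw p.1 (gaussianReal 0 (‖p.2‖₊ ^ 2)) P := by
  refine hasLaw_of_mem_span (X := fun x => U (cdf μ x)) (φ := bridgeVec μ) ?_ ?_ ?_
  · exact hU.isGaussian.comp_right fun x => (⟨cdf μ x, cdf_mem_Icc x⟩ : Icc (0 : ℝ) 1)
  · exact fun x => hU.mean_zero _ (cdf_mem_Icc x)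
  · intro x y
    rw [hU.covariance_eq _ (cdf_mem_Icc x) _ (cdf_mem_Icc y), inner_bridgeVec]

/-- `∫_0^T v(F) + e(T) v(F(T))`, a process with independent increments when `v` is a Brownian
bridge. -/
noncomputable def bridgeTransform (μ : Measure ℝ) (v : ℝ → ℝ) (T : ℝ) : ℝ :=
  (∫ t in (0 : ℝ)..T, v (cdf μ t)) + meanResidualLife μ T * v (cdf μ T)

lemma IsLifeLaw.continuous_comp_cdf (h : IsLifeLaw μ) {v : ℝ → ℝ}
    (hv : ContinuousOn v (Icc 0 1)) : Continuous fun t => v (cdf μ t) :=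
  hv.comp_continuous h.continuous_cdf cdf_mem_Icc

lemma IsLifeLaw.continuous_bridgeTransform (h : IsLifeLaw μ) {v : ℝ → ℝ}
    (hv : ContinuousOn v (Icc 0 1)) : Continuous (bridgeTransform μ v) :=
  (intervalIntegral.continuous_primitive
    (fun _ _ => (h.continuous_comp_cdf hv).intervalIntegrable _ _) 0).add
    (h.continuous_meanResidualLife.mul (h.continuous_comp_cdf hv))

lemma abs_bridgeIntegral_le {T : ℝ} (hT : 0 ≤ T) (y : ℝ) : |bridgeIntegral μ T y| ≤ T := by
  have := intervalIntegral.norm_integral_le_of_norm_le_const (a := 0) (b := T)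
    (f := fun t => bridgeFun μ t y) (C := 1) fun t _ => abs_bridgeFun_le t y
  simpa [abs_of_nonneg hT] using! this

lemma measurable_bridgeIntegral (T : ℝ) : Measurable (bridgeIntegral μ T) := by
  have h1 : StronglyMeasurable (Function.uncurry fun y t => bridgeFun μ t y) := by
    have : (Function.uncurry fun y t => bridgeFun μ t y)
        = fun p : ℝ × ℝ => {p : ℝ × ℝ | p.1 ≤ p.2}.indicator 1 p - cdf μ p.2 := by
      ext p; simp [bridgeFun, indicator_apply, Function.uncurry]
    rw [this]
    exact ((measurable_one.indicator (measurableSet_le measurable_fst measurable_snd)).sub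
      ((monotone_cdf μ).measurable.comp measurable_snd)).stronglyMeasurable
  have h2 : bridgeIntegral μ T = fun y => (∫ t in Ioc 0 T, bridgeFun μ t y)
      - ∫ t in Ioc T 0, bridgeFun μ t y := rfl
  rw [h2]
  exact (h1.integral_prod_right (ν := volume.restrict (Ioc 0 T))).measurable.sub
    (h1.integral_prod_right (ν := volume.restrict (Ioc T 0))).measurable

lemma memLp_bridgeIntegral {T : ℝ} (hT : 0 ≤ T) : MemLp (bridgeIntegral μ T) 2 μ :=
  MemLp.of_bound (measurable_bridgeIntegral T).aestronglyMeasurable T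
    (Eventually.of_forall fun y => abs_bridgeIntegral_le hT y)

/-- Riemann sums of the bridge lie in the span. They converge pathwise by continuity of U(F), and
the matching vectors converge in L² by bounded convergence, the integrand having its only jump at t
= y. -/
lemma gaussianClosure_integral (h : IsLifeLaw μ) (hU : IsBrownianBridge U P) {T : ℝ}
    (hT : 0 ≤ T) :
    GaussianClosure P (bridgeSpan μ U) (fun ω => ∫ t in (0 : ℝ)..T, U (cdf μ t) ω)
      ((memLp_bridgeIntegral hT).toLp _) := by
  have hmem (n : ℕ) : MemLp (fun y => ∑ k ∈ Finset.range (n + 1),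
      T / (n + 1) * bridgeFun μ (k * (T / (n + 1))) y) 2 μ :=
    memLp_finsetSum _ fun k _ => (memLp_bridgeFun _).const_mul _
  have hvec (n : ℕ) : (hmem n).toLp _ = ∑ k ∈ Finset.range (n + 1),
      (T / (n + 1)) • bridgeVec μ (k * (T / (n + 1))) := by
    rw [toLp_finsetSum (fun k => (memLp_bridgeFun _).const_mul _)]
    rfl
  refine .lim (fun n : ℕ => ∑ k ∈ Finset.range (n + 1),
      (T / (n + 1)) • U (cdf μ (k * (T / (n + 1)))))
    (fun n => ∑ k ∈ Finset.range (n + 1), (T / (n + 1)) • bridgeVec μ (k * (T / (n + 1)))) _ _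
    (fun n => GaussianClosure.sum _ fun k _ => GaussianClosure.smul _
      (.base _ _ (Submodule.subset_span ⟨_, rfl⟩))) ?_ ?_
  · filter_upwards [hU.continuous_paths] with ω hω
    have hc := h.continuous_comp_cdf hω
    obtain ⟨C, hC⟩ := (isCompact_Icc (a := 0) (b := T)).exists_bound_of_continuousOn hc.continuousOn
    have := tendsto_riemannSum hc.measurable hT hC
      (Eventually.of_forall fun t => hc.continuousAt)
    simpa using this
  · simp_rw [← hvec]
    refine tendsto_toLp_of_dominated hmem _ (memLp_const T)
      (Eventually.of_forall fun n => Eventually.of_forall fun y => ?_)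
      (Eventually.of_forall fun y => abs_bridgeIntegral_le hT y)
      (Eventually.of_forall fun y => ?_)
    · refine (Finset.abs_sum_le_sum_abs _ _).trans ?_
      calc ∑ k ∈ Finset.range (n + 1), |T / (n + 1) * bridgeFun μ (k * (T / (n + 1))) y|
          ≤ ∑ k ∈ Finset.range (n + 1), T / (n + 1) := by
            refine Finset.sum_le_sum fun k _ => ?_
            rw [abs_mul, abs_of_nonneg (by positivity : 0 ≤ T / (n + 1))]
            exact mul_le_of_le_one_right (by positivity) (abs_bridgeFun_le _ _)
        _ = T := by
            rw [Finset.sum_const, Finset.card_range, nsmul_eq_mul]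
            push_cast
            field_simp
    · refine tendsto_riemannSum (measurable_bridgeFun y) hT (fun t _ => abs_bridgeFun_le t y) ?_
      have hne : ∀ᵐ t : ℝ, t ≠ y := by simp [ae_iff]
      filter_upwards [hne] with t ht
      refine ContinuousAt.sub ?_ h.continuous_cdf.continuousAt
      rcases lt_or_gt_of_ne ht with ht | ht
      · refine continuousAt_const (y := (0 : ℝ)) |>.congr ?_
        filter_upwards [gt_mem_nhds ht] with s hs
        rw [indicator_of_notMem (by simpa using hs)]
      · refine continuousAt_const (y := (1 : ℝ)) |>.congr ?_
        filter_upwards [lt_mem_nhds ht] with s hs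
        rw [indicator_of_mem (by simpa using hs.le), Pi.one_apply]

lemma gaussianClosure_bridgeTransform (h : IsLifeLaw μ) (hU : IsBrownianBridge U P) {T : ℝ}
    (hT : 0 ≤ T) :
    GaussianClosure P (bridgeSpan μ U) (fun ω => bridgeTransform μ (fun u => U u ω) T)
      (mrlVec h T - mrlVec h 0) := by
  have h1 : mrlVec h T - mrlVec h 0
      = (memLp_bridgeIntegral hT).toLp _ + meanResidualLife μ T • bridgeVec μ T := by
    rw [mrlVec, mrlVec, bridgeVec, ← MemLp.toLp_sub, ← MemLp.toLp_const_smul, ← MemLp.toLp_add,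
      MemLp.toLp_eq_toLp_iff]
    filter_upwards [h.ae_pos] with y hy
    exact (bridgeIntegral_add h hT hy).symm
  rw [h1]
  exact (gaussianClosure_integral h hU hT).add
    (GaussianClosure.smul _ (.base _ _ (Submodule.subset_span ⟨_, rfl⟩)))

/-- The limit process `Z (1 - F)`. -/
noncomputable def scaledLimit (μ : Measure ℝ) (v : ℝ → ℝ) (x : ℝ) : ℝ :=
  limitMRL μ v x * survival μ x

/-- The Kronecker lemma shows that ∫_0^T v(F) has the same limit l as the full transform, so the
improper integral from x is l - ∫_0^x v(F). -/
lemma scaledLimit_eq (h : IsLifeLaw μ) {v : ℝ → ℝ} (hv : ContinuousOn v (Icc 0 1)) {l : ℝ}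
    (hl : Tendsto (bridgeTransform μ v) atTop (𝓝 l)) (x : ℝ) :
    scaledLimit μ v x = bridgeTransform μ v x - l := by
  have hc := h.continuous_comp_cdf hv
  have hA : Tendsto (fun T => ∫ t in (0 : ℝ)..T, v (cdf μ t)) atTop (𝓝 l) := by
    -- With M = v(F) / (1 - F), the product R M is e · v(F) and S M is v(F).
    refine tendsto_of_tendsto_add_mul (R := excess μ) (S := survival μ)
      (M := fun x => v (cdf μ x) / survival μ x) h.hasDerivAt_excess h.excess_pos survival_nonneg
      h.tendsto_excess (fun x => ?_) (hl.congr fun x => ?_)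
    · rw [mul_div_cancel₀ _ (h.survival_pos x).ne']
      exact intervalIntegral.integral_hasDerivAt_right (hc.intervalIntegrable _ _)
        (hc.stronglyMeasurableAtFilter _ _) hc.continuousAt
    · rw [bridgeTransform, meanResidualLife_eq]
      ring
  have hI : improperIntegral (fun t => v (cdf μ t)) x = l - ∫ t in (0 : ℝ)..x, v (cdf μ t) := by
    refine Tendsto.limUnder_eq ((hA.sub_const _).congr fun T => ?_)
    exact intervalIntegral.integral_interval_sub_left (hc.intervalIntegrable _ _)
      (hc.intervalIntegrable _ _)
  have := (h.survival_pos x).ne'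
  rw [scaledLimit, limitMRL, hI, bridgeTransform]
  field_simp
  ring

lemma ae_exists_tendsto_bridgeTransform (h : IsLifeLaw μ) (hU : IsBrownianBridge U P) :
    ∀ᵐ ω ∂P, ∃ l, Tendsto (bridgeTransform μ (fun u => U u ω)) atTop (𝓝 l) := by
  refine ae_exists_tendsto_atTop (hasLaw_of_mem_bridgeSpan (μ := μ) hU)
    (N := fun T ω => bridgeTransform μ (fun u => U u ω) T)
    (fun T hT => gaussianClosure_bridgeTransform h hU hT) (fun a b c d _ hab hbc hcd => ?_) ?_
    ((tendsto_mrlVec h).sub_const _)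
  · simp only [sub_sub_sub_cancel_right]
    exact inner_mrlVec_sub h hab hbc hcd
  · filter_upwards [hU.continuous_paths] with ω hω
    exact (h.continuous_bridgeTransform hω).continuousOn

lemma ae_continuous_scaledLimit (h : IsLifeLaw μ) (hU : IsBrownianBridge U P) :
    ∀ᵐ ω ∂P, Continuous (scaledLimit μ fun u => U u ω) ∧
      Tendsto (scaledLimit μ fun u => U u ω) atTop (𝓝 0) := by
  filter_upwards [hU.continuous_paths, ae_exists_tendsto_bridgeTransform h hU] with ω hω ⟨l, hl⟩
  have h1 : (scaledLimit μ fun u => U u ω) = fun x => bridgeTransform μ (fun u => U u ω) x - l :=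
    funext (scaledLimit_eq h hω hl)
  rw [h1]
  exact ⟨(h.continuous_bridgeTransform hω).sub continuous_const, by simpa using hl.sub_const l⟩

/-- The almost sure limit of the differences of the transform at x and at n; the vectors at n tend
to zero. -/
lemma gaussianClosure_scaledLimit (h : IsLifeLaw μ) (hU : IsBrownianBridge U P) {x : ℝ}
    (hx : 0 ≤ x) :
    GaussianClosure P (bridgeSpan μ U) (fun ω => scaledLimit μ (fun u => U u ω) x)
      (mrlVec h x) := by
  refine .lim (fun n : ℕ => (fun ω => bridgeTransform μ (fun u => U u ω) x)
      - fun ω => bridgeTransform μ (fun u => U u ω) n)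
    (fun n : ℕ => (mrlVec h x - mrlVec h 0) - (mrlVec h n - mrlVec h 0)) _ _
    (fun n => (gaussianClosure_bridgeTransform h hU hx).sub
      (gaussianClosure_bridgeTransform h hU n.cast_nonneg)) ?_ ?_
  · filter_upwards [hU.continuous_paths, ae_exists_tendsto_bridgeTransform h hU] with ω hω ⟨l, hl⟩
    rw [scaledLimit_eq h hω hl]
    exact (hl.comp tendsto_natCast_atTop_atTop).const_sub _
  · simpa using ((tendsto_mrlVec h).comp tendsto_natCast_atTop_atTop).const_sub (mrlVec h x)

end Limit

/-! ### Time reversal and time change to Brownian motion. -/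

section TimeChange

variable {Ω : Type*} [MeasurableSpace Ω] {P : Measure Ω} [IsProbabilityMeasure P]
  {μ : Measure ℝ} [IsProbabilityMeasure μ] {U : ℝ → Ω → ℝ}

/-- The element of `L²` corresponding to the time-reversed limit process. -/
noncomputable def reversedVec (h : IsLifeLaw μ) (s : ℝ) : Lp ℝ 2 μ :=
  open Classical in if s = 0 then 0 else mrlVec h (-Real.log s)

lemma reversedLimit_of_ne {s : ℝ} (hs : s ≠ 0) (ω : Ω) :
    reversedLimit μ U s ω = scaledLimit μ (fun u => U u ω) (-Real.log s) := by
  rw [reversedLimit, if_neg hs, scaledLimit]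

lemma reversedLimit_zero (ω : Ω) : reversedLimit μ U 0 ω = 0 := by
  rw [reversedLimit, if_pos rfl]

lemma neg_log_nonneg {s : ℝ} (hs : s ∈ Icc (0 : ℝ) 1) : 0 ≤ -Real.log s :=
  neg_nonneg.2 (Real.log_nonpos hs.1 hs.2)

lemma gaussianClosure_reversedLimit (h : IsLifeLaw μ) (hU : IsBrownianBridge U P) {s : ℝ}
    (hs : s ∈ Icc (0 : ℝ) 1) :
    GaussianClosure P (bridgeSpan μ U) (reversedLimit μ U s) (reversedVec h s) := by
  rcases eq_or_ne s 0 with rfl | h0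
  · have : reversedLimit μ U 0 = 0 := funext reversedLimit_zero
    rw [this, reversedVec, if_pos rfl]
    exact .zero
  · rw [funext (reversedLimit_of_ne h0), reversedVec, if_neg h0]
    exact gaussianClosure_scaledLimit h hU (neg_log_nonneg hs)

lemma tauSq_eq (h : IsLifeLaw μ) (hU : IsBrownianBridge U P) {s : ℝ} (hs : s ∈ Icc (0 : ℝ) 1) :
    tauSq μ P U s = ‖reversedVec h s‖ ^ 2 :=
  (gaussianClosure_reversedLimit h hU hs).variance_eq (hasLaw_of_mem_bridgeSpan hU)

lemma norm_reversedVec_strictMonoOn (h : IsLifeLaw μ) :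
    StrictMonoOn (fun s => ‖reversedVec h s‖ ^ 2) (Icc 0 1) := by
  intro s hs t ht hst
  have ht0 : t ≠ 0 := (hs.1.trans_lt hst).ne'
  simp only [reversedVec, if_neg ht0]
  rcases eq_or_ne s 0 with rfl | hs0
  · have h1 := norm_mrlVec_sq_strictAntiOn h (neg_log_nonneg ht)
      ((neg_log_nonneg ht).trans (lt_add_one _).le) (lt_add_one _)
    simp only [if_true, norm_zero]
    rw [zero_pow two_ne_zero]
    exact (sq_nonneg _).trans_lt h1
  · rw [if_neg hs0]
    exact norm_mrlVec_sq_strictAntiOn h (neg_log_nonneg ht) (neg_log_nonneg hs)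
      (neg_lt_neg (Real.log_lt_log (lt_of_le_of_ne hs.1 hs0.symm) hst))

lemma inner_reversedVec (h : IsLifeLaw μ) {s t : ℝ} (hs : s ∈ Icc (0 : ℝ) 1)
    (hst : s ≤ t) :
    inner ℝ (reversedVec h s) (reversedVec h t) = ‖reversedVec h s‖ ^ 2 := by
  rcases eq_or_ne s 0 with rfl | hs0
  · simp [reversedVec]
  · have hs1 : 0 < s := lt_of_le_of_ne hs.1 hs0.symm
    rw [reversedVec, reversedVec, if_neg hs0, if_neg (hs1.trans_le hst).ne', real_inner_comm]
    exact inner_mrlVec h (neg_le_neg (Real.log_le_log hs1 hst))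

lemma continuousOn_of_neg_log {E : Type*} [TopologicalSpace E] {z : ℝ → E} {w : ℝ → E} {c : E}
    (hz : Continuous z) (hz0 : Tendsto z atTop (𝓝 c)) (hw0 : w 0 = c)
    (hw : ∀ s, s ≠ 0 → w s = z (-Real.log s)) : ContinuousOn w (Icc 0 1) := by
  intro s hs
  rcases eq_or_ne s 0 with rfl | h0
  · rw [← continuousWithinAt_sdiff_self, ContinuousWithinAt, hw0]
    have h1 : Tendsto w (𝓝[>] 0) (𝓝 c) := by
      refine (hz0.comp (tendsto_neg_atBot_atTop.comp Real.tendsto_log_nhdsGT_zero)).congr' ?_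
      filter_upwards [self_mem_nhdsWithin] with s hs using (hw s (ne_of_gt hs)).symm
    exact h1.mono_left (nhdsWithin_mono 0 fun s hs => lt_of_le_of_ne hs.1.1 (Ne.symm hs.2))
  · refine ContinuousAt.continuousWithinAt ?_
    refine ((hz.continuousAt).comp (Real.continuousAt_log h0).neg).congr ?_
    filter_upwards [isOpen_ne.mem_nhds h0] with t ht
    exact (hw t ht).symm

lemma continuousOn_norm_reversedVec (h : IsLifeLaw μ) :
    ContinuousOn (fun s => ‖reversedVec h s‖ ^ 2) (Icc 0 1) :=
  (continuousOn_of_neg_log (continuous_mrlVec h) (tendsto_mrlVec h) (by simp [reversedVec])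
    fun s hs => by rw [reversedVec, if_neg hs]).norm.pow 2

lemma stdDev_sq : stdDev μ ^ 2 = Var[id; μ] := Real.sq_sqrt (variance_nonneg _ _)

lemma norm_reversedVec_one (h : IsLifeLaw μ) : ‖reversedVec h 1‖ ^ 2 = stdDev μ ^ 2 := by
  rw [stdDev_sq, ← norm_mrlVec_zero_sq h]; simp [reversedVec]

lemma norm_reversedVec_zero (h : IsLifeLaw μ) : ‖reversedVec h 0‖ ^ 2 = 0 := by
  simp [reversedVec]

lemma stdDev_pos (h : IsLifeLaw μ) : 0 < stdDev μ := by
  have h1 := norm_reversedVec_strictMonoOn h (left_mem_Icc.2 zero_le_one)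
    (right_mem_Icc.2 zero_le_one) one_pos
  simp only [norm_reversedVec_one, norm_reversedVec_zero] at h1
  exact lt_of_le_of_ne (Real.sqrt_nonneg _) fun h0 => by simp [← h0] at h1

/-- The time change `t ↦ g(σ² t)`. -/
noncomputable def timeChange (μ : Measure ℝ) (P : Measure Ω) (U : ℝ → Ω → ℝ) (t : ℝ) : ℝ :=
  Function.invFunOn (tauSq μ P U) (Icc (0 : ℝ) 1) (stdDev μ ^ 2 * t)

lemma timeChangedLimit_eq (t : ℝ) (ω : Ω) :
    timeChangedLimit μ P U t ω = (stdDev μ)⁻¹ * reversedLimit μ U (timeChange μ P U t) ω := rfl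

/-- The intermediate value theorem shows that σ² t is a value of τ² on [0, 1], so
`Function.invFunOn` returns a true preimage rather than its default. -/
lemma timeChange_spec (h : IsLifeLaw μ) (hU : IsBrownianBridge U P) {t : ℝ}
    (ht : t ∈ Icc (0 : ℝ) 1) : timeChange μ P U t ∈ Icc (0 : ℝ) 1 ∧
      ‖reversedVec h (timeChange μ P U t)‖ ^ 2 = stdDev μ ^ 2 * t := by
  have hex : ∃ s ∈ Icc (0 : ℝ) 1, tauSq μ P U s = stdDev μ ^ 2 * t := by
    have h1 := intermediate_value_Icc zero_le_one (continuousOn_norm_reversedVec h)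
    simp only [norm_reversedVec_one, norm_reversedVec_zero] at h1
    obtain ⟨s, hs, hst⟩ := h1 ⟨mul_nonneg (sq_nonneg _) ht.1, mul_le_of_le_one_right (sq_nonneg _) ht.2⟩
    exact ⟨s, hs, by rw [tauSq_eq h hU hs]; exact hst⟩
  have hmem := Function.invFunOn_mem hex
  refine ⟨hmem, ?_⟩
  rw [timeChange, ← tauSq_eq h hU hmem]
  exact Function.invFunOn_eq hex

lemma timeChange_surjOn (h : IsLifeLaw μ) (hU : IsBrownianBridge U P) :
    SurjOn (timeChange μ P U) (Icc 0 1) (Icc 0 1) := by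
  intro s hs
  have hσ : 0 < stdDev μ ^ 2 := pow_pos (stdDev_pos h) 2
  have hmono := (norm_reversedVec_strictMonoOn h).monotoneOn
  have ht : ‖reversedVec h s‖ ^ 2 / stdDev μ ^ 2 ∈ Icc (0 : ℝ) 1 := by
    refine ⟨by positivity, (div_le_one hσ).2 ?_⟩
    rw [← norm_reversedVec_one h]
    exact hmono hs (right_mem_Icc.2 zero_le_one) hs.2
  obtain ⟨h1, h2⟩ := timeChange_spec h hU ht
  refine ⟨_, ht, (norm_reversedVec_strictMonoOn h).injOn h1 hs ?_⟩
  rw [mul_div_cancel₀ _ hσ.ne'] at h2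
  exact h2

lemma timeChange_monotoneOn (h : IsLifeLaw μ) (hU : IsBrownianBridge U P) :
    MonotoneOn (timeChange μ P U) (Icc 0 1) := by
  intro s hs t ht hst
  obtain ⟨h1, h2⟩ := timeChange_spec h hU hs
  obtain ⟨h3, h4⟩ := timeChange_spec h hU ht
  refine ((norm_reversedVec_strictMonoOn h).le_iff_le h1 h3).1 ?_
  simp only [h2, h4]
  gcongr

/-- A monotone surjection of [0, 1] onto itself is continuous. -/
lemma continuousOn_timeChange (h : IsLifeLaw μ) (hU : IsBrownianBridge U P) :
    ContinuousOn (timeChange μ P U) (Icc 0 1) := by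
  let g : Icc (0 : ℝ) 1 → Icc (0 : ℝ) 1 :=
    fun t => ⟨timeChange μ P U t, (timeChange_spec h hU t.2).1⟩
  have hg : Continuous g := by
    refine Monotone.continuous_of_surjective
      (fun s t hst => timeChange_monotoneOn h hU s.2 t.2 hst) fun s => ?_
    obtain ⟨t, ht, hts⟩ := timeChange_surjOn h hU s.2
    exact ⟨⟨t, ht⟩, Subtype.ext hts⟩
  rw [continuousOn_iff_continuous_domRestrict]
  exact continuous_subtype_val.comp hg

lemma ae_continuousOn_reversedLimit (h : IsLifeLaw μ) (hU : IsBrownianBridge U P) :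
    ∀ᵐ ω ∂P, ContinuousOn (fun s => reversedLimit μ U s ω) (Icc 0 1) := by
  filter_upwards [ae_continuous_scaledLimit h hU] with ω ⟨hc, h0⟩
  exact continuousOn_of_neg_log hc h0 (reversedLimit_zero ω) fun s hs => reversedLimit_of_ne hs ω

lemma isBrownianMotion_timeChangedLimit (h : IsLifeLaw μ) (hU : IsBrownianBridge U P) :
    IsBrownianMotion (timeChangedLimit μ P U) P := by
  have hcl (t : ℝ) (ht : t ∈ Icc (0 : ℝ) 1) : GaussianClosure P (bridgeSpan μ U)
      (timeChangedLimit μ P U t) ((stdDev μ)⁻¹ • reversedVec h (timeChange μ P U t)) :=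
    (gaussianClosure_reversedLimit h hU (timeChange_spec h hU ht).1).smul _
  have hG := hasLaw_of_mem_bridgeSpan (μ := μ) hU
  have hσ := (stdDev_pos h).ne'
  have hle : ∀ s ∈ Icc (0 : ℝ) 1, ∀ t ∈ Icc (0 : ℝ) 1, s ≤ t →
      inner ℝ ((stdDev μ)⁻¹ • reversedVec h (timeChange μ P U s))
        ((stdDev μ)⁻¹ • reversedVec h (timeChange μ P U t)) = s := by
    intro s hs t ht hst
    rw [real_inner_smul_left, real_inner_smul_right, inner_reversedVec h (timeChange_spec h hU hs).1
      (timeChange_monotoneOn h hU hs ht hst),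
      (timeChange_spec h hU hs).2]
    field_simp
  refine ⟨GaussianClosure.isGaussianProcess hG fun t => hcl t t.2,
    fun t ht => (hcl t ht).integral_eq_zero hG, fun s hs t ht => ?_, ?_⟩
  · rw [(hcl s hs).covariance_eq hG (hcl t ht)]
    rcases le_total s t with hst | hst
    · rw [hle s hs t ht hst, min_eq_left hst]
    · rw [real_inner_comm, hle t ht s hs hst, min_eq_right hst]
  · filter_upwards [ae_continuousOn_reversedLimit h hU] with ω hω
    exact (hω.comp (continuousOn_timeChange h hU)
      fun t ht => (timeChange_spec h hU ht).1).const_mul _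

lemma bddAbove_abs_of_tendsto {z : ℝ → ℝ} {l : ℝ} (hz : Continuous z)
    (hl : Tendsto z atTop (𝓝 l)) (a : ℝ) : BddAbove ((fun x => |z x|) '' Ici a) := by
  obtain ⟨T, hT⟩ := eventually_atTop.1 (hl.abs.eventually_lt_const (lt_add_one |l|))
  obtain ⟨C, hC⟩ := (isCompact_Icc (a := a) (b := T)).bddAbove_image hz.abs.continuousOn
  refine ⟨max C (|l| + 1), ?_⟩
  rintro _ ⟨x, hx, rfl⟩
  rcases le_total T x with hTx | hTx
  · exact (hT x hTx).le.trans (le_max_right _ _)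
  · exact (hC ⟨x, ⟨hx, hTx⟩, rfl⟩).trans (le_max_left _ _)

lemma supAbs_scaledLimit_eq (h : IsLifeLaw μ) (hU : IsBrownianBridge U P) {ω : Ω}
    (hc : Continuous (scaledLimit μ fun u => U u ω))
    (h0 : Tendsto (scaledLimit μ fun u => U u ω) atTop (𝓝 0)) :
    supAbs (Ici 0) (scaledLimit μ fun u => U u ω)
      = stdDev μ * supAbs (Icc 0 1) (fun t => timeChangedLimit μ P U t ω) := by
  have hσ := stdDev_pos h
  have hbdd := bddAbove_abs_of_tendsto hc h0 0
  have h1 : (fun t => |timeChangedLimit μ P U t ω|) '' Icc 0 1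
      = (fun y => (stdDev μ)⁻¹ • y) '' ((fun s => |reversedLimit μ U s ω|) '' Icc 0 1) := by
    have h2 : timeChange μ P U '' Icc 0 1 = Icc 0 1 :=
      (timeChange_surjOn h hU).image_eq_of_mapsTo fun t ht => (timeChange_spec h hU ht).1
    conv_rhs => rw [← h2, image_image, image_image]
    refine image_congr fun t _ => ?_
    rw [timeChangedLimit_eq, abs_mul, abs_of_pos (inv_pos.2 hσ), smul_eq_mul]
  -- The point s = 0, which corresponds to x = ∞, only adds the value 0; this does not change a
  -- supremum of absolute values.
  have h3 : (fun s => |reversedLimit μ U s ω|) '' Icc 0 1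
      = insert 0 ((fun x => |scaledLimit μ (fun u => U u ω) x|) '' Ici 0) := by
    ext y
    simp only [mem_image, mem_insert_iff]
    constructor
    · rintro ⟨s, hs, rfl⟩
      rcases eq_or_ne s 0 with rfl | hs0
      · left; rw [reversedLimit_zero, abs_zero]
      · right; exact ⟨_, neg_log_nonneg hs, by rw [reversedLimit_of_ne hs0]⟩
    · rintro (rfl | ⟨x, hx, rfl⟩)
      · exact ⟨0, left_mem_Icc.2 zero_le_one, by rw [reversedLimit_zero, abs_zero]⟩
      · refine ⟨Real.exp (-x), ⟨(Real.exp_pos _).le, Real.exp_le_one_iff.2 (neg_nonpos.2 hx)⟩, ?_⟩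
        rw [reversedLimit_of_ne (Real.exp_ne_zero _), Real.log_exp, neg_neg]
  have hne : ((fun x => |scaledLimit μ (fun u => U u ω) x|) '' Ici 0).Nonempty :=
    nonempty_Ici.image _
  rw [supAbs, supAbs, h1, image_smul, Real.sSup_smul_of_nonneg (inv_nonneg.2 hσ.le), h3,
    csSup_insert hbdd hne, sup_eq_right.2, smul_eq_mul, mul_inv_cancel_left₀ hσ.ne']
  exact Real.sSup_nonneg (by rintro _ ⟨x, _, rfl⟩; exact abs_nonneg _)

end TimeChange

/-! ### Relative error of the uniform empirical survival function. -/

section Ratio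

lemma empiricalCdf_eq_sum {n : ℕ} (x : Fin n → ℝ) (t : ℝ) :
    empiricalCdf x t = (∑ i, (Iic t).indicator (1 : ℝ → ℝ) (x i)) / n := by
  rw [empiricalCdf, Nat.card_eq_fintype_card, Fintype.card_subtype]
  simp [indicator_apply]

lemma empiricalCdf_mono {n : ℕ} (x : Fin n → ℝ) : Monotone (empiricalCdf x) := by
  intro s t hst
  rw [empiricalCdf_eq_sum, empiricalCdf_eq_sum]
  refine div_le_div_of_nonneg_right (Finset.sum_le_sum fun i _ => ?_) n.cast_nonneg
  exact indicator_le_indicator_of_subset (Iic_subset_Iic.2 hst) (fun _ => zero_le_one' ℝ) _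

variable {Ω : Type*} [MeasurableSpace Ω] {P : Measure Ω} [IsProbabilityMeasure P]
  {n : ℕ} {ξ : Fin n → Ω → ℝ}
  (hlaw : ∀ i, HasLaw (ξ i) (volume.restrict (Ioo (0 : ℝ) 1)) P) (hind : iIndepFun ξ P)

lemma volume_real_restrict_Iic {t : ℝ} (ht : t ∈ Icc (0 : ℝ) 1) :
    (volume.restrict (Ioo (0 : ℝ) 1)).real (Iic t) = t := by
  rw [measureReal_restrict_apply measurableSet_Iic]
  refine le_antisymm ?_ ?_
  · calc volume.real (Iic t ∩ Ioo 0 1) ≤ volume.real (Icc 0 t) :=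
        measureReal_mono (fun x hx => ⟨hx.2.1.le, hx.1⟩) (by simp)
      _ = t := by simp [ht.1]
  · calc t = volume.real (Ioo 0 t) := by simp [ht.1]
      _ ≤ volume.real (Iic t ∩ Ioo 0 1) :=
        measureReal_mono (fun x hx => ⟨hx.2.le, hx.1, hx.2.trans_le ht.2⟩)
        (measure_ne_top_of_subset inter_subset_right (by simp))

include hlaw

lemma memLp_indicator (t : ℝ) (i : Fin n) :
    MemLp (fun ω => (Iic t).indicator (1 : ℝ → ℝ) (ξ i ω)) 2 P := by
  refine MemLp.of_bound ((measurable_one.indicator measurableSet_Iic).comp_aemeasurable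
    (hlaw i).aemeasurable).aestronglyMeasurable 1 (Eventually.of_forall fun ω => ?_)
  rw [indicator_apply]
  split_ifs <;> simp

lemma integral_indicator_uniform {t : ℝ} (ht : t ∈ Icc (0 : ℝ) 1) (i : Fin n) :
    ∫ ω, (Iic t).indicator (1 : ℝ → ℝ) (ξ i ω) ∂P = t := by
  have h1 := integral_map (hlaw i).aemeasurable (f := (Iic t).indicator (1 : ℝ → ℝ))
    (measurable_one.indicator measurableSet_Iic).aestronglyMeasurable
  rw [← h1, (hlaw i).map_eq, integral_indicator_one measurableSet_Iic,
    volume_real_restrict_Iic ht]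

lemma variance_indicator_uniform {t : ℝ} (ht : t ∈ Icc (0 : ℝ) 1) (i : Fin n) :
    Var[fun ω => (Iic t).indicator (1 : ℝ → ℝ) (ξ i ω); P] ≤ 1 - t := by
  rw [variance_eq_sub (memLp_indicator hlaw t i), integral_indicator_uniform hlaw ht]
  have h1 : (fun ω => (Iic t).indicator (1 : ℝ → ℝ) (ξ i ω)) ^ 2
      = fun ω => (Iic t).indicator (1 : ℝ → ℝ) (ξ i ω) := by
    ext ω; simp [indicator_apply]
  rw [h1, integral_indicator_uniform hlaw ht]
  nlinarith [ht.1, ht.2, sq_nonneg (1 - t)]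

include hind

/-- Chebyshev's inequality for the uniform empirical distribution function. -/
lemma measure_le_abs_empiricalCdf_sub (hn : 0 < n) {s δ : ℝ} (hs : s ∈ Ioc (0 : ℝ) 1)
    (hδ : 0 < δ) :
    P {ω | δ * s ≤ |(1 - empiricalCdf (fun i => ξ i ω) (1 - s)) - s|}
      ≤ ENNReal.ofReal (1 / (n * δ ^ 2) * (1 / s)) := by
  have ht : 1 - s ∈ Icc (0 : ℝ) 1 := ⟨by linarith [hs.2], by linarith [hs.1]⟩
  have hn' : (0 : ℝ) < n := by exact_mod_cast hn
  have hs0 := hs.1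
  let X : Ω → ℝ := fun ω => (n : ℝ)⁻¹ * ∑ i, (Iic (1 - s)).indicator (1 : ℝ → ℝ) (ξ i ω)
  have hX : MemLp X 2 P := (memLp_finsetSum _ fun i _ => memLp_indicator hlaw (1 - s) i).const_mul _
  have hmean : P[X] = 1 - s := by
    simp only [X]
    rw [integral_const_mul, integral_finsetSum _
      fun i _ => (memLp_indicator hlaw (1 - s) i).integrable (by norm_num)]
    simp_rw [integral_indicator_uniform hlaw ht]
    simp
    field_simp
  have hvar : Var[X; P] ≤ s / n := by
    have h1 := IndepFun.variance_sum (s := Finset.univ)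
      (X := fun i ω => (Iic (1 - s)).indicator (1 : ℝ → ℝ) (ξ i ω))
      (fun i _ => memLp_indicator hlaw (1 - s) i) fun i _ j _ hij =>
        (hind.indepFun hij).comp (measurable_one.indicator measurableSet_Iic)
          (measurable_one.indicator measurableSet_Iic)
    have h2 : X = fun ω => (n : ℝ)⁻¹ * (∑ i, fun ω => (Iic (1 - s)).indicator (1 : ℝ → ℝ) (ξ i ω)) ω := by
      ext ω; simp [X]
    rw [h2, variance_const_mul, h1]
    have h3 : ∑ i, Var[fun ω => (Iic (1 - s)).indicator (1 : ℝ → ℝ) (ξ i ω); P] ≤ n * s := by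
      refine (Finset.sum_le_sum fun i _ => variance_indicator_uniform hlaw ht i).trans ?_
      simp
    calc (n : ℝ)⁻¹ ^ 2 * _ ≤ (n : ℝ)⁻¹ ^ 2 * (n * s) := by gcongr
      _ = s / n := by field_simp
  have hset : {ω | δ * s ≤ |(1 - empiricalCdf (fun i => ξ i ω) (1 - s)) - s|}
      = {ω | δ * s ≤ |X ω - P[X]|} := by
    ext ω
    simp only [mem_ofPred_eq]
    rw [hmean, empiricalCdf_eq_sum, ← abs_neg]
    congr! 2
    simp only [X]
    ring
  rw [hset]
  refine (meas_ge_le_variance_div_sq hX (mul_pos hδ hs0)).trans (ENNReal.ofReal_le_ofReal ?_)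
  calc Var[X; P] / (δ * s) ^ 2 ≤ s / n / (δ * s) ^ 2 := by gcongr
    _ = 1 / (n * δ ^ 2) * (1 / s) := by field_simp

/-- The relative error of the uniform empirical survival function is small on `[0, 1 - a]` when
`n a` is large. -/
lemma measure_exists_empirical_ratio_le (hn : 0 < n) {ρ δ a : ℝ} (hρ : ρ ∈ Ioo (0 : ℝ) 1)
    (hδ : 0 < δ) (hδ1 : δ ≤ 1) (ha : a ∈ Ioc (0 : ℝ) 1) :
    P {ω | ∃ s ∈ Icc a 1, 1 - empiricalCdf (fun i => ξ i ω) (1 - s) ∉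
        Icc ((1 - δ) * ρ * s) ((1 + δ) / ρ * s)}
      ≤ ENNReal.ofReal (1 / (δ ^ 2 * ρ ^ 2 * (1 / ρ - 1)) * (1 / (n * a))) := by
  obtain ⟨hρ0, hρ1⟩ := hρ
  have hn' : (0 : ℝ) < n := by exact_mod_cast hn
  -- Here ρ^(K+1) < a ≤ ρ^K, so the powers with exponents 0, …, K + 1 bracket every s in [a, 1];
  -- monotonicity costs a factor ρ on either side.
  obtain ⟨K, hK1, hK2⟩ := exists_nat_pow_near_of_lt_one ha.1 ha.2 hρ0 hρ1
  have hpow (k : ℕ) : ρ ^ k ∈ Ioc (0 : ℝ) 1 := ⟨pow_pos hρ0 k, pow_le_one₀ hρ0.le hρ1.le⟩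
  have hsub : {ω | ∃ s ∈ Icc a 1, 1 - empiricalCdf (fun i => ξ i ω) (1 - s) ∉
        Icc ((1 - δ) * ρ * s) ((1 + δ) / ρ * s)}
      ⊆ ⋃ k ∈ Finset.range (K + 2),
        {ω | δ * ρ ^ k ≤ |(1 - empiricalCdf (fun i => ξ i ω) (1 - ρ ^ k)) - ρ ^ k|} := by
    rintro ω ⟨s, hs, hnot⟩
    by_contra hcon
    simp only [mem_iUnion, mem_ofPred_eq, not_exists, not_le, Finset.mem_range] at hcon
    apply hnot
    obtain ⟨k, hk1, hk2⟩ := exists_nat_pow_near_of_lt_one (ha.1.trans_le hs.1) hs.2 hρ0 hρ1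
    have hkK : k < K + 1 := by
      by_contra hlt
      have := pow_le_pow_of_le_one hρ0.le hρ1.le (not_lt.1 hlt)
      linarith [hs.1]
    have h1 := abs_lt.1 (hcon k (by omega))
    have h2 := abs_lt.1 (hcon (k + 1) (by omega))
    have m1 := empiricalCdf_mono (fun i => ξ i ω) (sub_le_sub_left hk2 1)
    have m2 := empiricalCdf_mono (fun i => ξ i ω) (sub_le_sub_left hk1.le 1)
    have hks : ρ * s ≤ ρ ^ (k + 1) := by
      rw [pow_succ']; gcongr
    have hks' : ρ ^ k ≤ s / ρ := by
      rw [le_div_iff₀ hρ0, ← pow_succ]; exact hk1.le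
    constructor
    · calc (1 - δ) * ρ * s = (1 - δ) * (ρ * s) := by ring
        _ ≤ (1 - δ) * ρ ^ (k + 1) := by gcongr
        _ ≤ _ := by linarith [h2.1]
    · calc _ ≤ (1 + δ) * ρ ^ k := by linarith [h1.2]
        _ ≤ (1 + δ) * (s / ρ) := by gcongr
        _ = _ := by ring
  refine (measure_mono hsub).trans ((measure_biUnion_finset_le _ _).trans ?_)
  refine (Finset.sum_le_sum fun k _ =>
    measure_le_abs_empiricalCdf_sub hlaw hind hn (hpow k) hδ).trans ?_
  rw [← ENNReal.ofReal_sum_of_nonneg fun k _ => by positivity]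
  refine ENNReal.ofReal_le_ofReal ?_
  have hr : 1 < 1 / ρ := (one_lt_div hρ0).2 hρ1
  have hr' : 0 < 1 / ρ - 1 := sub_pos.2 hr
  -- The geometric sum is controlled by its largest term, of order 1 / a; this is what makes n a → ∞
  -- sufficient.
  have hgeom : ∑ k ∈ Finset.range (K + 2), 1 / ρ ^ k ≤ 1 / ρ ^ 2 * (1 / a) / (1 / ρ - 1) := by
    simp_rw [← one_div_pow]
    rw [geom_sum_eq hr.ne']
    gcongr
    have h1 : (1 / ρ) ^ (K + 2) ≤ (1 / ρ) ^ 2 * (1 / a) := by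
      rw [pow_add, mul_comm]
      gcongr
      rw [one_div_pow]
      exact one_div_le_one_div_of_le ha.1 hK2
    linarith
  rw [← Finset.mul_sum]
  calc 1 / (n * δ ^ 2) * ∑ k ∈ Finset.range (K + 2), 1 / ρ ^ k
      ≤ 1 / (n * δ ^ 2) * (1 / ρ ^ 2 * (1 / a) / (1 / ρ - 1)) := by gcongr
    _ = _ := by
      have := ha.1
      field_simp

end Ratio

/-! ### The empirical process as a rescaled mean of influence functions. -/

section Empirical

variable {μ : Measure ℝ} [IsProbabilityMeasure μ] {n : ℕ} {u : Fin n → ℝ}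

lemma empiricalSurvival_eq (h : IsLifeLaw μ) (hu : ∀ i, u i ∈ Ioo (0 : ℝ) 1) {x : ℝ}
    (hx : 0 ≤ x) : empiricalSurvival μ u x = 1 - empiricalCdf u (cdf μ x) := by
  rw [empiricalSurvival, empiricalCdf, empiricalCdf]
  simp only [quantileSample, h.quantile_le_iff (Ioo_subset_Ico_self (hu _)) hx]

/-- The rescaled empirical mean of the influence function. -/
noncomputable def empiricalScaled (μ : Measure ℝ) {n : ℕ} (u : Fin n → ℝ) (x : ℝ) : ℝ :=
  √(n : ℝ) * ((∑ i, mrlFun μ x (quantile μ (u i))) / n)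

lemma uniformEmpirical_cdf (h : IsLifeLaw μ) (hn : 0 < n) (hu : ∀ i, u i ∈ Ioo (0 : ℝ) 1)
    {x : ℝ} (hx : 0 ≤ x) : uniformEmpirical u (cdf μ x)
      = √(n : ℝ) * (survival μ x - (∑ i, (Iio (quantile μ (u i))).indicator 1 x) / n) := by
  have hn' : (n : ℝ) ≠ 0 := by exact_mod_cast hn.ne'
  have h1 (i : Fin n) : (Iic (cdf μ x)).indicator (1 : ℝ → ℝ) (u i)
      = 1 - (Iio (quantile μ (u i))).indicator 1 x := by
    have := h.quantile_le_iff (Ioo_subset_Ico_self (hu i)) hx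
    simp only [indicator_apply, mem_Iic, mem_Iio, Pi.one_apply, ← this, ← not_le (a := quantile _ _)]
    split_ifs <;> simp
  rw [uniformEmpirical, empiricalCdf_eq_sum]
  simp_rw [h1]
  rw [Finset.sum_sub_distrib, survival]
  simp
  field_simp
  left
  ring

lemma integral_indicator_Iio (x y : ℝ) :
    ∫ t in Ioi x, (Iio y).indicator (1 : ℝ → ℝ) t = max (y - x) 0 := by
  rw [integral_indicator_one measurableSet_Iio, measureReal_restrict_apply measurableSet_Iio,
    inter_comm, Ioi_inter_Iio, Real.volume_real_Ioo]

lemma integrableOn_indicator_Iio (x y : ℝ) :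
    IntegrableOn ((Iio y).indicator (1 : ℝ → ℝ)) (Ioi x) := by
  rw [IntegrableOn, integrable_indicator_iff measurableSet_Iio, IntegrableOn,
    Measure.restrict_restrict measurableSet_Iio, inter_comm, Ioi_inter_Iio]
  exact integrableOn_const (by simp)

lemma integral_uniformEmpirical_cdf (h : IsLifeLaw μ) (hn : 0 < n)
    (hu : ∀ i, u i ∈ Ioo (0 : ℝ) 1) {x : ℝ} (hx : 0 ≤ x) :
    ∫ t in Ioi x, uniformEmpirical u (cdf μ t)
      = √(n : ℝ) * (excess μ x - (∑ i, max (quantile μ (u i) - x) 0) / n) := by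
  rw [setIntegral_congr_fun measurableSet_Ioi fun t (ht : x < t) =>
    uniformEmpirical_cdf h hn hu (hx.trans ht.le)]
  rw [integral_const_mul, integral_sub (h.integrableOn_survival x)
    ((integrable_finsetSum _ fun i _ => integrableOn_indicator_Iio x _).div_const _),
    integral_div, integral_finsetSum _ fun i _ => integrableOn_indicator_Iio x _]
  simp_rw [integral_indicator_Iio]
  rfl

/-- Below the largest observation the normalising factor is nonzero and cancels. From there on the
empirical survival function and every summand vanish. For n = 0 the factor √n is zero. -/
lemma empiricalMRL_mul_empiricalSurvival (h : IsLifeLaw μ) (hu : ∀ i, u i ∈ Ioo (0 : ℝ) 1)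
    {x : ℝ} (hx : 0 ≤ x) :
    empiricalMRL μ u x * empiricalSurvival μ u x = empiricalScaled μ u x := by
  rcases Nat.eq_zero_or_pos n with rfl | hn
  · simp [empiricalMRL, empiricalScaled, uniformEmpirical]
  have hn' : (n : ℝ) ≠ 0 := by exact_mod_cast hn.ne'
  have : Nonempty (Fin n) := ⟨⟨0, hn⟩⟩
  obtain ⟨j, hj⟩ := exists_eq_ciSup_of_finite (f := u)
  have hsurv := empiricalSurvival_eq h hu hx
  rw [empiricalMRL, ← hj]
  split_ifs with hlt
  · have hne : 1 - empiricalCdf u (cdf μ x) ≠ 0 := by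
      rw [← not_le, h.quantile_le_iff (Ioo_subset_Ico_self (hu j)) hx, not_le] at hlt
      have h1 : ∑ i, (Iic (cdf μ x)).indicator (1 : ℝ → ℝ) (u i) < ∑ _i : Fin n, (1 : ℝ) := by
        refine Finset.sum_lt_sum (fun i _ => indicator_le_self' (fun _ _ => zero_le_one) _)
          ⟨j, Finset.mem_univ _, ?_⟩
        rw [indicator_of_notMem (by simpa using hlt)]
        exact one_pos
      rw [empiricalCdf_eq_sum, sub_ne_zero]
      refine (ne_of_lt ?_).symm
      rw [div_lt_one (by positivity)]
      simpa using h1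
    rw [hsurv, integral_uniformEmpirical_cdf h hn hu hx, uniformEmpirical_cdf h hn hu hx,
      empiricalScaled]
    simp_rw [mrlFun_eq]
    rw [Finset.sum_sub_distrib, ← Finset.mul_sum, ← h.meanResidualLife_mul_survival]
    have h2 (i : Fin n) : (Iio (quantile μ (u i))).indicator (1 : ℝ → ℝ) x
        = (Ioi x).indicator 1 (quantile μ (u i)) := by simp [indicator_apply]
    simp_rw [h2]
    field_simp
    ring
  · have hle (i : Fin n) : u i ≤ cdf μ x := by
      rw [not_lt, h.quantile_le_iff (Ioo_subset_Ico_self (hu j)) hx, hj] at hlt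
      exact (le_ciSup (finite_range u).bddAbove i).trans hlt
    have h0 : empiricalSurvival μ u x = 0 := by
      rw [hsurv, empiricalCdf_eq_sum]
      have h1 (i : Fin n) : (Iic (cdf μ x)).indicator (1 : ℝ → ℝ) (u i) = 1 :=
        indicator_of_mem (s := Iic (cdf μ x)) (hle i) 1
      simp_rw [h1]
      simp [hn']
    have h1 (i : Fin n) : mrlFun μ x (quantile μ (u i)) = 0 :=
      mrlFun_of_le ((h.quantile_le_iff (Ioo_subset_Ico_self (hu i)) hx).2 (hle i))
    rw [h0, mul_zero, empiricalScaled]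
    simp [h1]

lemma continuousWithinAt_mrlFun (h : IsLifeLaw μ) (x y : ℝ) :
    ContinuousWithinAt (fun x => mrlFun μ x y) (Ici x) x := by
  rcases lt_or_ge x y with hxy | hxy
  · refine ContinuousAt.continuousWithinAt ?_
    refine ContinuousAt.congr (f := fun x => y - x - meanResidualLife μ x)
      ((continuous_const.sub continuous_id).sub h.continuous_meanResidualLife).continuousAt ?_
    filter_upwards [gt_mem_nhds hxy] with z hz
    rw [mrlFun_of_lt hz]
  · refine continuousWithinAt_const (b := (0 : ℝ)) |>.congr (fun z hz => ?_) (mrlFun_of_le hxy)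
    exact mrlFun_of_le (hxy.trans hz)

lemma continuousWithinAt_empiricalScaled (h : IsLifeLaw μ) (u : Fin n → ℝ) (x : ℝ) :
    ContinuousWithinAt (empiricalScaled μ u) (Ici x) x :=
  ((tendsto_finsetSum _ fun _ _ => continuousWithinAt_mrlFun h x _).div_const _).const_mul _

lemma abs_mrlFun_le (x y : ℝ) : |mrlFun μ x y| ≤ |y| + |x + meanResidualLife μ x| := by
  rcases lt_or_ge x y with hy | hy
  · rw [mrlFun_of_lt hy, sub_sub]
    exact abs_sub _ _
  · rw [mrlFun_of_le hy, abs_zero]; positivity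

lemma bddAbove_empiricalScaled (h : IsLifeLaw μ) (u : Fin n → ℝ) (b : ℝ) :
    BddAbove ((fun x => |empiricalScaled μ u x|) '' Icc 0 b) := by
  obtain ⟨C, hC⟩ := (isCompact_Icc (a := (0 : ℝ)) (b := b)).bddAbove_image
    (continuous_id.add h.continuous_meanResidualLife).abs.continuousOn
  refine ⟨√(n : ℝ) * ((∑ i, (|quantile μ (u i)| + C)) / n), ?_⟩
  rintro _ ⟨x, hx, rfl⟩
  simp only [empiricalScaled]
  rw [abs_mul, abs_div, abs_of_nonneg (Real.sqrt_nonneg _), Nat.abs_cast]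
  gcongr
  refine (Finset.abs_sum_le_sum_abs _ _).trans (Finset.sum_le_sum fun i _ => ?_)
  exact (abs_mrlFun_le x _).trans (by gcongr; exact hC ⟨x, hx, rfl⟩)

/-- The supremum of a right-continuous function is reached along the rationals and the right
endpoint. -/
lemma sSup_image_Icc_eq {g : ℝ → ℝ} {b : ℝ} (hb : 0 ≤ b)
    (hg : ∀ x, ContinuousWithinAt g (Ici x) x) (hbdd : BddAbove (g '' Icc 0 b)) :
    sSup (g '' Icc 0 b) = sSup (g '' insert b (range ((↑) : ℚ → ℝ) ∩ Icc 0 b)) := by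
  have hsub : insert b (range ((↑) : ℚ → ℝ) ∩ Icc 0 b) ⊆ Icc 0 b :=
    insert_subset ⟨hb, le_rfl⟩ inter_subset_right
  have hbdd' := hbdd.mono (image_mono hsub)
  refine le_antisymm (csSup_le ((nonempty_Icc.2 hb).image _) ?_)
    (csSup_le_csSup hbdd ((insert_nonempty _ _).image _) (image_mono hsub))
  rintro _ ⟨x, hx, rfl⟩
  rcases hx.2.eq_or_lt with rfl | hxb
  · exact le_csSup hbdd' ⟨x, mem_insert _ _, rfl⟩
  · by_contra! hlt
    have hev : ∀ᶠ y in 𝓝[>] x, sSup (g '' insert b (range ((↑) : ℚ → ℝ) ∩ Icc 0 b)) < g y :=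
      ((hg x).mono Ioi_subset_Ici_self).eventually_const_lt hlt
    obtain ⟨c, hc, hc'⟩ := (mem_nhdsGT_iff_exists_Ioo_subset' hxb).1 hev
    obtain ⟨q, hq1, hq2⟩ := exists_rat_btwn (lt_min hc hxb)
    have h1 : sSup (g '' insert b (range ((↑) : ℚ → ℝ) ∩ Icc 0 b)) < g q :=
      hc' ⟨hq1, hq2.trans_le (min_le_left _ _)⟩
    refine absurd (le_csSup hbdd' ⟨(q : ℝ), mem_insert_of_mem _ ⟨⟨q, rfl⟩, hx.1.trans hq1.le,
      (hq2.trans_le (min_le_right _ _)).le⟩, rfl⟩) (not_le.2 h1)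

variable {Ω : Type*} [MeasurableSpace Ω] {P : Measure Ω} [IsProbabilityMeasure P]
  {ξ : Fin n → Ω → ℝ} (hlaw : ∀ i, HasLaw (ξ i) (volume.restrict (Ioo (0 : ℝ) 1)) P)
include hlaw

lemma ae_mem_Ioo : ∀ᵐ ω ∂P, ∀ i, ξ i ω ∈ Ioo (0 : ℝ) 1 := by
  rw [ae_all_iff]
  intro i
  have h1 : ∀ᵐ x ∂(P.map (ξ i)), x ∈ Ioo (0 : ℝ) 1 := by
    rw [(hlaw i).map_eq]
    exact ae_restrict_mem measurableSet_Ioo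
  exact ae_of_ae_map (hlaw i).aemeasurable h1

lemma aemeasurable_quantile (h : IsLifeLaw μ) (i : Fin n) :
    AEMeasurable (fun ω => quantile μ (ξ i ω)) P := by
  have hq : MonotoneOn (quantile μ) (Ioo 0 1) := fun s hs t ht hst => by
    rw [h.quantile_le_iff (Ioo_subset_Ico_self hs) (quantile_nonneg _),
      h.cdf_quantile (Ioo_subset_Ico_self ht)]
    exact hst
  have h1 := aemeasurable_restrict_of_monotoneOn (μ := volume) measurableSet_Ioo hq
  rw [← (hlaw i).map_eq] at h1
  exact h1.comp_aemeasurable (hlaw i).aemeasurable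

lemma aemeasurable_empiricalScaled (h : IsLifeLaw μ) (x : ℝ) :
    AEMeasurable (fun ω => empiricalScaled μ (fun i => ξ i ω) x) P := by
  have h1 : Measurable (mrlFun μ x) :=
    ((measurable_id.sub_const _).sub_const _).indicator measurableSet_Ioi
  exact ((Finset.aemeasurable_fun_sum _ fun i _ =>
    h1.comp_aemeasurable (aemeasurable_quantile hlaw h i)).div_const _).const_mul _

/-- Right continuity in x reduces the supremum to countably many points. -/
lemma aemeasurable_supAbs_empiricalScaled (h : IsLifeLaw μ) {b : ℝ} (hb : 0 ≤ b) :
    AEMeasurable (fun ω => supAbs (Icc 0 b) (empiricalScaled μ (fun i => ξ i ω))) P := by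
  have h1 : (fun ω => supAbs (Icc 0 b) (empiricalScaled μ (fun i => ξ i ω))) = fun ω =>
      ⨆ x : (insert b (range ((↑) : ℚ → ℝ) ∩ Icc 0 b) : Set ℝ),
        |empiricalScaled μ (fun i => ξ i ω) x| := by
    ext ω
    rw [supAbs, sSup_image_Icc_eq hb (fun x => (continuousWithinAt_empiricalScaled h _ x).abs)
      (bddAbove_empiricalScaled h _ b), image_eq_range]
    rfl
  rw [h1]
  have : Countable (insert b (range ((↑) : ℚ → ℝ) ∩ Icc 0 b) : Set ℝ) :=
    (((countable_range _).mono inter_subset_left).insert b).to_subtype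
  exact AEMeasurable.iSup fun x => (aemeasurable_empiricalScaled hlaw h x).abs

end Empirical

/-! ### Suprema of absolute values. -/

section SupAbs

lemma supAbs_nonneg (s : Set ℝ) (g : ℝ → ℝ) : 0 ≤ supAbs s g :=
  Real.sSup_nonneg (by rintro _ ⟨x, _, rfl⟩; exact abs_nonneg _)

lemma supAbs_le {s : Set ℝ} {g : ℝ → ℝ} {C : ℝ} (hC : 0 ≤ C) (h : ∀ x ∈ s, |g x| ≤ C) :
    supAbs s g ≤ C :=
  Real.sSup_le (by rintro _ ⟨x, hx, rfl⟩; exact h x hx) hC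

lemma abs_le_supAbs {s : Set ℝ} {g : ℝ → ℝ} (h : BddAbove ((fun x => |g x|) '' s)) {x : ℝ}
    (hx : x ∈ s) : |g x| ≤ supAbs s g :=
  le_csSup h ⟨x, hx, rfl⟩

lemma supAbs_congr {s : Set ℝ} {f g : ℝ → ℝ} (h : ∀ x ∈ s, f x = g x) :
    supAbs s f = supAbs s g := by
  rw [supAbs, supAbs, image_congr fun x hx => by rw [h x hx]]

/-- Boundedness has to be assumed because the real `sSup` of an unbounded set is 0. -/
lemma abs_supAbs_sub_le {s : Set ℝ} {f g : ℝ → ℝ} (hf : BddAbove ((fun x => |f x|) '' s))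
    (hg : BddAbove ((fun x => |g x|) '' s)) :
    |supAbs s f - supAbs s g| ≤ supAbs s (fun x => f x - g x) := by
  have hfg : BddAbove ((fun x => |f x - g x|) '' s) := by
    refine ⟨supAbs s f + supAbs s g, ?_⟩
    rintro _ ⟨x, hx, rfl⟩
    exact (abs_sub _ _).trans (add_le_add (abs_le_supAbs hf hx) (abs_le_supAbs hg hx))
  have h1 : supAbs s f ≤ supAbs s (fun x => f x - g x) + supAbs s g := by
    refine supAbs_le (add_nonneg (supAbs_nonneg _ _) (supAbs_nonneg _ _)) fun x hx => ?_
    have := abs_add_le (f x - g x) (g x)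
    rw [sub_add_cancel] at this
    exact this.trans (add_le_add (abs_le_supAbs hfg hx) (abs_le_supAbs hg hx))
  have h2 : supAbs s g ≤ supAbs s (fun x => f x - g x) + supAbs s f := by
    refine supAbs_le (add_nonneg (supAbs_nonneg _ _) (supAbs_nonneg _ _)) fun x hx => ?_
    have := abs_sub (f x) (f x - g x)
    rw [sub_sub_cancel] at this
    linarith [abs_le_supAbs hfg hx, abs_le_supAbs hf hx]
  rw [abs_le]
  constructor <;> linarith

lemma supAbs_mono {s t : Set ℝ} {g : ℝ → ℝ} (hst : s ⊆ t)
    (ht : BddAbove ((fun x => |g x|) '' t)) : supAbs s g ≤ supAbs t g :=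
  supAbs_le (supAbs_nonneg _ _) fun _ hx => abs_le_supAbs ht (hst hx)

lemma tendsto_supAbs_Icc {z : ℝ → ℝ} (hz : BddAbove ((fun x => |z x|) '' Ici 0)) {b : ℕ → ℝ}
    (hb : Tendsto b atTop atTop) :
    Tendsto (fun n => supAbs (Icc 0 (b n)) z) atTop (𝓝 (supAbs (Ici 0) z)) := by
  refine tendsto_order.2 ⟨fun c hc => ?_, fun c hc => Eventually.of_forall fun n =>
    (supAbs_mono Icc_subset_Ici_self hz).trans_lt hc⟩
  obtain ⟨_, ⟨x, hx, rfl⟩, hcx⟩ := exists_lt_of_lt_csSup (nonempty_Ici.image _) hc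
  filter_upwards [hb.eventually_ge_atTop x] with n hn
  exact hcx.trans_le (abs_le_supAbs (hz.mono (image_mono Icc_subset_Ici_self)) ⟨hx, hn⟩)

end SupAbs

/-! ### Convergence in probability and in distribution. -/

section Convergence

variable {Ω : Type*} [MeasurableSpace Ω] {P : Measure Ω} [IsProbabilityMeasure P]
  {μ : Measure ℝ} [IsProbabilityMeasure μ] {U : ℝ → Ω → ℝ}

lemma ae_bddAbove_scaledLimit (h : IsLifeLaw μ) (hU : IsBrownianBridge U P) :
    ∀ᵐ ω ∂P, BddAbove ((fun x => |scaledLimit μ (fun u => U u ω) x|) '' Ici 0) := by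
  filter_upwards [ae_continuous_scaledLimit h hU] with ω hω
  exact bddAbove_abs_of_tendsto hω.1 hω.2 0

lemma aemeasurable_supAbs_scaledLimit_Icc (h : IsLifeLaw μ) (hU : IsBrownianBridge U P) {b : ℝ}
    (hb : 0 ≤ b) :
    AEMeasurable (fun ω => supAbs (Icc 0 b) (scaledLimit μ fun u => U u ω)) P := by
  have : Countable (insert b (range ((↑) : ℚ → ℝ) ∩ Icc 0 b) : Set ℝ) :=
    (((countable_range _).mono inter_subset_left).insert b).to_subtype
  have h1 : AEMeasurable (fun ω => ⨆ x : (insert b (range ((↑) : ℚ → ℝ) ∩ Icc 0 b) : Set ℝ),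
      |scaledLimit μ (fun u => U u ω) x|) P := by
    refine AEMeasurable.iSup fun x => AEMeasurable.abs ?_
    have hx : 0 ≤ (x : ℝ) := by
      rcases x.2 with hx | hx
      · rw [hx]; exact hb
      · exact hx.2.1
    exact ((gaussianClosure_scaledLimit h hU hx).hasLaw (hasLaw_of_mem_bridgeSpan hU)).aemeasurable
  refine h1.congr ?_
  filter_upwards [ae_continuous_scaledLimit h hU] with ω ⟨hc, hl⟩
  rw [supAbs, sSup_image_Icc_eq hb (fun x => hc.abs.continuousAt.continuousWithinAt)
    ((bddAbove_abs_of_tendsto hc hl 0).mono (image_mono Icc_subset_Ici_self)), image_eq_range]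
  rfl

lemma aemeasurable_supAbs_scaledLimit (h : IsLifeLaw μ) (hU : IsBrownianBridge U P) :
    AEMeasurable (fun ω => supAbs (Ici 0) (scaledLimit μ fun u => U u ω)) P := by
  refine aemeasurable_of_tendsto_metrizable_ae' (f := fun (n : ℕ) ω =>
    supAbs (Icc 0 n) (scaledLimit μ fun u => U u ω))
    (fun n => aemeasurable_supAbs_scaledLimit_Icc h hU n.cast_nonneg) ?_
  filter_upwards [ae_bddAbove_scaledLimit h hU] with ω hω
  exact tendsto_supAbs_Icc hω tendsto_natCast_atTop_atTop

/-- Tightness of a single real variable. -/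
lemma exists_measure_lt_lt {B : Ω → ℝ} (hB : AEMeasurable B P) {θ : ENNReal} (hθ : 0 < θ) :
    ∃ M : ℝ, 0 < M ∧ P {ω | M < B ω} < θ := by
  have h1 := tendsto_measure_iInter_atTop (μ := P) (s := fun m : ℕ => {ω | (m + 1 : ℝ) < B ω})
    (fun m => nullMeasurableSet_lt aemeasurable_const hB)
    (fun i j hij ω (hω : (j + 1 : ℝ) < B ω) => by
      have : (i : ℝ) ≤ j := by exact_mod_cast hij
      exact lt_of_le_of_lt (by linarith) hω) ⟨0, measure_ne_top _ _⟩
  have h2 : ⋂ m : ℕ, {ω | (m + 1 : ℝ) < B ω} = ∅ := by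
    ext ω
    simp only [mem_iInter, mem_ofPred_eq, mem_empty_iff_false, iff_false, not_forall, not_lt]
    obtain ⟨m, hm⟩ := exists_nat_ge (B ω)
    exact ⟨m, by linarith⟩
  rw [h2, measure_empty] at h1
  obtain ⟨m, hm⟩ := (h1.eventually_lt_const hθ).exists
  exact ⟨m + 1, by positivity, hm⟩

variable {ξ : (n : ℕ) → Fin n → Ω → ℝ} {a : ℕ → ℝ}

/-- On the range `[0, b_n]` the empirical survival function is uniformly close to the true one, in
relative error. -/
lemma tendsto_measure_survival_ratio (h : IsLifeLaw μ) (ha : Tendsto a atTop (𝓝 0))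
    (hna : Tendsto (fun n : ℕ => (n : ℝ) * a n) atTop atTop)
    (hlaw : ∀ n i, HasLaw (ξ n i) (volume.restrict (Ioo (0 : ℝ) 1)) P)
    (hind : ∀ n, iIndepFun (ξ n) P) {ε : ℝ} (hε : ε ∈ Ioc (0 : ℝ) 1) :
    Tendsto (fun n => P {ω | ∃ x ∈ Icc 0 (quantile μ (1 - a n)),
      ε * survival μ x < |empiricalSurvival μ (fun i => ξ n i ω) x - survival μ x|}) atTop
      (𝓝 0) := by
  obtain ⟨hε0, hε1⟩ := hε
  -- The choice ρ = 1 - ε/4 and δ = ε/4 keeps (1 - δ)ρ above 1 - ε and (1 + δ)/ρ below 1 + ε.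
  have hlim : Tendsto (fun n : ℕ => ENNReal.ofReal
      (1 / ((ε / 4) ^ 2 * (1 - ε / 4) ^ 2 * (1 / (1 - ε / 4) - 1)) * (1 / (n * a n)))) atTop
      (𝓝 0) := by
    rw [← ENNReal.ofReal_zero]
    refine ENNReal.tendsto_ofReal ?_
    have h1 := hna.inv_tendsto_atTop.const_mul
      (1 / ((ε / 4) ^ 2 * (1 - ε / 4) ^ 2 * (1 / (1 - ε / 4) - 1)))
    rw [mul_zero] at h1
    exact h1.congr fun n => by rw [Pi.inv_apply, one_div (_ * a n)]
  refine tendsto_of_tendsto_of_tendsto_of_le_of_le' tendsto_const_nhds hlim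
    (Eventually.of_forall fun _ => zero_le) ?_
  filter_upwards [hna.eventually_gt_atTop 0, ha.eventually_lt_const one_pos,
    eventually_gt_atTop 0] with n h0 h1 hn
  have ha0 : 0 < a n := pos_of_mul_pos_right h0 n.cast_nonneg
  refine (measure_mono_ae (t := {ω | ∃ s ∈ Icc (a n) 1,
    1 - empiricalCdf (fun i => ξ n i ω) (1 - s) ∉
      Icc ((1 - ε / 4) * (1 - ε / 4) * s) ((1 + ε / 4) / (1 - ε / 4) * s)}) ?_).trans
    (measure_exists_empirical_ratio_le (hlaw n) (hind n) hn ⟨by linarith, by linarith⟩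
      (by linarith) (by linarith) ⟨ha0, h1.le⟩)
  filter_upwards [ae_mem_Ioo (hlaw n)] with ω hω
  rintro ⟨x, hx, hlt⟩
  refine ⟨survival μ x, ⟨?_, survival_le_one x⟩, fun hmem => ?_⟩
  · have := monotone_cdf μ hx.2
    rw [h.cdf_quantile ⟨by linarith, by linarith⟩] at this
    rw [survival]; linarith
  · have hS := h.survival_pos x
    have hx1 : 1 - survival μ x = cdf μ x := by rw [survival]; ring
    rw [hx1, ← empiricalSurvival_eq h hω hx.1] at hmem
    refine absurd hlt (not_lt.2 (abs_le.2 ⟨?_, ?_⟩))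
    · have h2 : (1 - ε) * survival μ x ≤ (1 - ε / 4) * (1 - ε / 4) * survival μ x := by
        gcongr
        nlinarith
      linarith [hmem.1]
    · have h2 : (1 + ε / 4) / (1 - ε / 4) * survival μ x ≤ (1 + ε) * survival μ x := by
        gcongr
        rw [div_le_iff₀ (by linarith)]
        nlinarith
      linarith [hmem.2]

lemma supAbs_sub_le_of_ratio (h : IsLifeLaw μ) {n : ℕ} {u : Fin n → ℝ}
    (hu : ∀ i, u i ∈ Ioo (0 : ℝ) 1) {v : ℝ → ℝ} {b ε : ℝ} (hε : ε ∈ Ioc (0 : ℝ) (1 / 2))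
    (hz : BddAbove ((fun x => |scaledLimit μ v x|) '' Ici 0))
    (hratio : ∀ x ∈ Icc 0 b,
      |empiricalSurvival μ u x - survival μ x| ≤ ε * survival μ x) :
    supAbs (Icc 0 b)
        (fun x => empiricalMRL μ u x * empiricalSurvival μ u x - limitMRL μ v x * survival μ x)
      ≤ 2 * supAbs (Icc 0 b) (fun x => (empiricalMRL μ u x - limitMRL μ v x) * survival μ x)
        + ε * supAbs (Ici 0) (scaledLimit μ v) := by
  obtain ⟨hε0, hε1⟩ := hε
  have hpos (x : ℝ) (hx : x ∈ Icc 0 b) : survival μ x / 2 ≤ empiricalSurvival μ u x := by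
    have h1 := (abs_le.1 (hratio x hx)).1
    have := mul_le_mul_of_nonneg_right hε1 (h.survival_pos x).le
    linarith
  -- Without boundedness the supremum in the hypothesis would be 0 by convention and control
  -- nothing. It comes from that of Z_n times the empirical survival function, since the ratio of
  -- survival functions is at least 1/2.
  have hbdd : BddAbove ((fun x => |(empiricalMRL μ u x - limitMRL μ v x) * survival μ x|) ''
      Icc 0 b) := by
    have hY := bddAbove_empiricalScaled h u b
    refine ⟨2 * supAbs (Icc 0 b) (empiricalScaled μ u) + supAbs (Ici 0) (scaledLimit μ v), ?_⟩
    rintro _ ⟨x, hx, rfl⟩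
    have hS := h.survival_pos x
    have h1 := abs_le_supAbs hY hx
    have h2 := abs_le_supAbs hz (show x ∈ Ici 0 from hx.1)
    rw [← empiricalMRL_mul_empiricalSurvival h hu hx.1, abs_mul] at h1
    have h3 : |empiricalMRL μ u x| * survival μ x
        ≤ 2 * (|empiricalMRL μ u x| * |empiricalSurvival μ u x|) := by
      have := mul_le_mul_of_nonneg_left ((hpos x hx).trans (le_abs_self _))
        (abs_nonneg (empiricalMRL μ u x))
      linarith
    calc |(empiricalMRL μ u x - limitMRL μ v x) * survival μ x|
        = |empiricalMRL μ u x * survival μ x - scaledLimit μ v x| := by rw [scaledLimit, sub_mul]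
      _ ≤ |empiricalMRL μ u x * survival μ x| + |scaledLimit μ v x| := abs_sub _ _
      _ ≤ _ := by rw [abs_mul, abs_of_pos hS]; linarith
  refine supAbs_le (by have := supAbs_nonneg (Ici 0) (scaledLimit μ v)
                       have := supAbs_nonneg (Icc 0 b)
                         (fun x => (empiricalMRL μ u x - limitMRL μ v x) * survival μ x)
                       positivity) fun x hx => ?_
  have hS := h.survival_pos x
  have hA := abs_le_supAbs hbdd hx
  have hB := abs_le_supAbs hz (show x ∈ Ici 0 from hx.1)
  set q := empiricalSurvival μ u x / survival μ x with hq
  have hqS : empiricalSurvival μ u x = q * survival μ x := by rw [hq, div_mul_cancel₀ _ hS.ne']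
  have hr := hratio x hx
  have hq1 : |q - 1| ≤ ε := by
    rw [hqS, ← sub_one_mul, abs_mul, abs_of_pos hS] at hr
    exact le_of_mul_le_mul_right hr hS
  have hq2 : |q| ≤ 2 := by
    have := abs_le.1 hq1
    rw [abs_le]; constructor <;> linarith
  have hid : empiricalMRL μ u x * empiricalSurvival μ u x - limitMRL μ v x * survival μ x
      = q * ((empiricalMRL μ u x - limitMRL μ v x) * survival μ x)
        + (q - 1) * scaledLimit μ v x := by
    rw [hqS, scaledLimit]; ring
  rw [hid]
  refine (abs_add_le _ _).trans ?_
  rw [abs_mul q, abs_mul (q - 1)]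
  exact add_le_add (mul_le_mul hq2 hA (abs_nonneg _) zero_le_two)
    (mul_le_mul hq1 hB (abs_nonneg _) hε0.le)

lemma tendstoInMeasure_supAbs_scaled (h : IsLifeLaw μ) (ha : Tendsto a atTop (𝓝 0))
    (hna : Tendsto (fun n : ℕ => (n : ℝ) * a n) atTop atTop)
    (hlaw : ∀ n i, HasLaw (ξ n i) (volume.restrict (Ioo (0 : ℝ) 1)) P)
    (hind : ∀ n, iIndepFun (ξ n) P) (hU : IsBrownianBridge U P)
    (hconv : TendstoInMeasure P
      (fun n ω => supAbs (Icc 0 (quantile μ (1 - a n)))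
        (fun x => (empiricalMRL μ (fun i => ξ n i ω) x - limitMRL μ (fun u => U u ω) x)
          * survival μ x))
      atTop (fun _ => 0)) :
    TendstoInMeasure P
      (fun n ω => supAbs (Icc 0 (quantile μ (1 - a n)))
        (fun x => empiricalMRL μ (fun i => ξ n i ω) x * empiricalSurvival μ (fun i => ξ n i ω) x
          - limitMRL μ (fun u => U u ω) x * survival μ x))
      atTop (fun _ => 0) := by
  rw [tendstoInMeasure_iff_norm] at hconv ⊢
  simp only [sub_zero, Real.norm_of_nonneg (supAbs_nonneg _ _)] at hconv ⊢
  intro η hη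
  rw [ENNReal.tendsto_nhds_zero]
  intro θ hθ
  have hθ3 : 0 < θ / 3 := ENNReal.div_pos hθ.ne' (by simp)
  obtain ⟨M, hM, hMθ⟩ := exists_measure_lt_lt (aemeasurable_supAbs_scaledLimit h hU) hθ3
  -- Off the exceptional events the bound is 2 · η/4 + ε M ≤ 3η/4 < η.
  have hε : min (1 / 2) (η / (4 * M)) ∈ Ioc (0 : ℝ) (1 / 2) := ⟨by positivity, min_le_left _ _⟩
  set ε := min (1 / 2) (η / (4 * M)) with hεdef
  have hεM : ε * M ≤ η / 4 := by
    calc ε * M ≤ η / (4 * M) * M := by gcongr; exact min_le_right _ _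
      _ = η / 4 := by field_simp
  filter_upwards [(hconv (η / 4) (by positivity)).eventually_le_const hθ3,
    (tendsto_measure_survival_ratio h ha hna hlaw hind (ε := ε)
      ⟨hε.1, hε.2.trans (by norm_num)⟩).eventually_le_const hθ3] with n h1 h2
  refine (measure_mono_ae (t := ({ω | η / 4 ≤ supAbs (Icc 0 (quantile μ (1 - a n)))
        (fun x => (empiricalMRL μ (fun i => ξ n i ω) x - limitMRL μ (fun u => U u ω) x)
          * survival μ x)} ∪ {ω | ∃ x ∈ Icc 0 (quantile μ (1 - a n)),
      ε * survival μ x < |empiricalSurvival μ (fun i => ξ n i ω) x - survival μ x|}) ∪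
      {ω | M < supAbs (Ici 0) (scaledLimit μ fun u => U u ω)}) ?_).trans ?_
  · filter_upwards [ae_mem_Ioo (hlaw n), ae_bddAbove_scaledLimit h hU] with ω hω hz hη'
    by_contra hcon
    change ω ∉ (_ : Set Ω) at hcon
    simp only [mem_ofPred_eq, mem_union, not_or, not_exists, not_and, not_le, not_lt] at hcon
    obtain ⟨⟨h3, h4⟩, h5⟩ := hcon
    have h6 := supAbs_sub_le_of_ratio h hω hε hz h4
    have h7 := mul_le_mul_of_nonneg_left h5 hε.1.le
    have h8 : η ≤ supAbs (Icc 0 (quantile μ (1 - a n)))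
        (fun x => empiricalMRL μ (fun i => ξ n i ω) x * empiricalSurvival μ (fun i => ξ n i ω) x
          - limitMRL μ (fun u => U u ω) x * survival μ x) := hη'
    linarith
  · calc _ ≤ θ / 3 + θ / 3 + θ / 3 :=
        (measure_union_le _ _).trans (add_le_add ((measure_union_le _ _).trans (add_le_add h1 h2))
          hMθ.le)
      _ = θ := ENNReal.add_thirds θ

/-- Suprema over [0, b_n] differ by at most the supremum of the difference, and the supremum of the
limit over [0, b_n] converges pathwise because b_n → ∞. -/
lemma tendstoInMeasure_supAbs_empirical (h : IsLifeLaw μ) (ha : Tendsto a atTop (𝓝 0))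
    (hna : Tendsto (fun n : ℕ => (n : ℝ) * a n) atTop atTop)
    (hlaw : ∀ n i, HasLaw (ξ n i) (volume.restrict (Ioo (0 : ℝ) 1)) P)
    (hU : IsBrownianBridge U P)
    (hconv : TendstoInMeasure P
      (fun n ω => supAbs (Icc 0 (quantile μ (1 - a n)))
        (fun x => empiricalMRL μ (fun i => ξ n i ω) x * empiricalSurvival μ (fun i => ξ n i ω) x
          - limitMRL μ (fun u => U u ω) x * survival μ x))
      atTop (fun _ => 0)) :
    TendstoInMeasure P
      (fun n ω => supAbs (Icc 0 (quantile μ (1 - a n)))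
        (fun x => empiricalMRL μ (fun i => ξ n i ω) x * empiricalSurvival μ (fun i => ξ n i ω) x))
      atTop (fun ω => supAbs (Ici 0) (scaledLimit μ fun u => U u ω)) := by
  have ha' : ∀ᶠ n in atTop, 0 < a n := by
    filter_upwards [hna.eventually_gt_atTop 0] with n h0
    exact pos_of_mul_pos_right h0 n.cast_nonneg
  have hB : TendstoInMeasure P
      (fun n ω => supAbs (Icc 0 (quantile μ (1 - a n))) (scaledLimit μ fun u => U u ω))
      atTop (fun ω => supAbs (Ici 0) (scaledLimit μ fun u => U u ω)) := by
    refine tendstoInMeasure_of_tendsto_ae (fun n =>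
      (aemeasurable_supAbs_scaledLimit_Icc h hU (quantile_nonneg _)).aestronglyMeasurable) ?_
    filter_upwards [ae_bddAbove_scaledLimit h hU] with ω hω
    exact tendsto_supAbs_Icc hω (tendsto_quantile h ha ha')
  rw [tendstoInMeasure_iff_norm] at hconv hB ⊢
  simp only [sub_zero, Real.norm_of_nonneg (supAbs_nonneg _ _)] at hconv
  intro η hη
  have hsum := (hconv (η / 2) (half_pos hη)).add (hB (η / 2) (half_pos hη))
  rw [add_zero] at hsum
  refine tendsto_of_tendsto_of_tendsto_of_le_of_le tendsto_const_nhds hsum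
    (fun _ => zero_le) fun n => ?_
  refine (measure_mono_ae (t := {ω | η / 2 ≤ supAbs (Icc 0 (quantile μ (1 - a n)))
        (fun x => empiricalMRL μ (fun i => ξ n i ω) x * empiricalSurvival μ (fun i => ξ n i ω) x
          - limitMRL μ (fun u => U u ω) x * survival μ x)} ∪
      {ω | η / 2 ≤ ‖supAbs (Icc 0 (quantile μ (1 - a n))) (scaledLimit μ fun u => U u ω)
        - supAbs (Ici 0) (scaledLimit μ fun u => U u ω)‖}) ?_).trans (measure_union_le _ _)
  filter_upwards [ae_mem_Ioo (hlaw n), ae_bddAbove_scaledLimit h hU] with ω hω hz hη'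
  by_contra hcon
  change ω ∉ (_ : Set Ω) at hcon
  simp only [mem_ofPred_eq, not_or, not_le] at hcon
  have hbdd : BddAbove ((fun x => |empiricalMRL μ (fun i => ξ n i ω) x
      * empiricalSurvival μ (fun i => ξ n i ω) x|) '' Icc 0 (quantile μ (1 - a n))) := by
    rw [image_congr fun x hx => by rw [empiricalMRL_mul_empiricalSurvival h hω hx.1]]
    exact bddAbove_empiricalScaled h _ _
  have h1 := abs_supAbs_sub_le hbdd (hz.mono (image_mono Icc_subset_Ici_self))
  have h2 : η ≤ ‖_‖ := hη'
  have h3 := abs_sub_le (supAbs (Icc 0 (quantile μ (1 - a n)))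
    (fun x => empiricalMRL μ (fun i => ξ n i ω) x * empiricalSurvival μ (fun i => ξ n i ω) x))
    (supAbs (Icc 0 (quantile μ (1 - a n))) (scaledLimit μ fun u => U u ω))
    (supAbs (Ici 0) (scaledLimit μ fun u => U u ω))
  rw [Real.norm_eq_abs] at h2 hcon
  simp only [scaledLimit] at *
  linarith [hcon.1, hcon.2]

end Convergence

end MeanResidualLife

theorem mainTheorem8
    {Ω : Type*} [MeasurableSpace Ω] (P : Measure Ω) [IsProbabilityMeasure P]
    -- the law of `X`: a positive density on `[0, ∞)` and finite variance
    (μ : Measure ℝ) [IsProbabilityMeasure μ] (f : ℝ → ℝ) (hf : Measurable f)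
    (hf_pos : ∀ x, 0 ≤ x → 0 < f x)
    (hμ : μ = (volume.restrict (Ici (0 : ℝ))).withDensity (fun x => ENNReal.ofReal (f x)))
    (hvar : MemLp id 2 μ)
    -- the truncation levels
    (a : ℕ → ℝ) (ha_nonneg : ∀ n, 0 ≤ a n) (ha : Tendsto a atTop (𝓝 0))
    (hna : Tendsto (fun n : ℕ => (n : ℝ) * a n) atTop atTop)
    -- for each `n`, a sample of `n` independent uniform variables
    (ξ : (n : ℕ) → Fin n → Ω → ℝ)
    (hξ_law : ∀ n i, HasLaw (ξ n i) (volume.restrict (Ioo (0 : ℝ) 1)) P)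
    (hξ_indep : ∀ n, iIndepFun (ξ n) P)
    -- a Brownian bridge on the same probability space
    (U : ℝ → Ω → ℝ) (hU : IsBrownianBridge U P)
    -- `sup_{x ≤ b_n} |Z_n(x) - Z(x)| (1 - F(x)) → 0` in probability
    (hconv : TendstoInMeasure P
      (fun n ω => supAbs (Icc 0 (quantile μ (1 - a n)))
        (fun x => (empiricalMRL μ (fun i => ξ n i ω) x - limitMRL μ (fun u => U u ω) x)
          * survival μ x))
      atTop (fun _ => 0)) :
    -- `sup_{x ≤ b_n} |Z_n (1 - F_n) - Z (1 - F)| → 0` in probability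
    TendstoInMeasure P
      (fun n ω => supAbs (Icc 0 (quantile μ (1 - a n)))
        (fun x => empiricalMRL μ (fun i => ξ n i ω) x * empiricalSurvival μ (fun i => ξ n i ω) x
          - limitMRL μ (fun u => U u ω) x * survival μ x))
      atTop (fun _ => 0) ∧
    -- `sup_{[0, b_n]} |Z_n (1 - F_n)|` converges in distribution to `sup_{[0, ∞)} |Z (1 - F)|`
    TendstoInDistribution
      (fun n ω => supAbs (Icc 0 (quantile μ (1 - a n)))
        (fun x => empiricalMRL μ (fun i => ξ n i ω) x * empiricalSurvival μ (fun i => ξ n i ω) x))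
      atTop
      (fun ω => supAbs (Ici 0) (fun x => limitMRL μ (fun u => U u ω) x * survival μ x))
      (fun _ => P) P ∧
    -- all these suprema are almost surely finite
    (∀ n, ∀ᵐ ω ∂P,
      BddAbove ((fun x => |empiricalMRL μ (fun i => ξ n i ω) x
        * empiricalSurvival μ (fun i => ξ n i ω) x|) '' Icc 0 (quantile μ (1 - a n)))) ∧
    (∀ᵐ ω ∂P,
      BddAbove ((fun x => |limitMRL μ (fun u => U u ω) x * survival μ x|) '' Ici 0)) ∧
    -- the limit is `σ sup_{[0, 1]} |W|`, and `W` is a standard Brownian motion on `[0, 1]`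
    (∀ᵐ ω ∂P,
      supAbs (Ici 0) (fun x => limitMRL μ (fun u => U u ω) x * survival μ x)
        = stdDev μ * supAbs (Icc 0 1) (fun t => timeChangedLimit μ P U t ω)) ∧
    IsBrownianMotion (timeChangedLimit μ P U) P := by
  have h := isLifeLaw_of_density hf hf_pos hμ hvar
  have h1 := tendstoInMeasure_supAbs_scaled h ha hna hξ_law hξ_indep hU hconv
  have hcongr (n : ℕ) : ∀ᵐ ω ∂P, ∀ x ∈ Icc 0 (quantile μ (1 - a n)),
      empiricalMRL μ (fun i => ξ n i ω) x * empiricalSurvival μ (fun i => ξ n i ω) x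
        = empiricalScaled μ (fun i => ξ n i ω) x := by
    filter_upwards [ae_mem_Ioo (hξ_law n)] with ω hω x hx
    exact empiricalMRL_mul_empiricalSurvival h hω hx.1
  refine ⟨h1, ?_, fun n => ?_, ae_bddAbove_scaledLimit h hU, ?_,
    isBrownianMotion_timeChangedLimit h hU⟩
  · refine (tendstoInMeasure_supAbs_empirical h ha hna hξ_law hU
      h1).tendstoInDistribution_of_aemeasurable (fun n => ?_) (aemeasurable_supAbs_scaledLimit h hU)
    -- Measurability is transferred from the right-continuous rescaled mean, which agrees on [0,
    -- b_n] whenever all ξ_{ni} lie in (0, 1).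
    refine (aemeasurable_supAbs_empiricalScaled (hξ_law n) h
      (quantile_nonneg (μ := μ) (1 - a n))).congr ?_
    filter_upwards [hcongr n] with ω hω
    exact (supAbs_congr hω).symm
  · filter_upwards [hcongr n] with ω hω
    rw [image_congr fun x hx => by rw [hω x hx]]
    exact bddAbove_empiricalScaled h _ _
  · filter_upwards [ae_continuous_scaledLimit h hU] with ω hω
    exact supAbs_scaledLimit_eq h hU hω.1 hω.2
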